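/- Let $M$ be a smooth $3$-dimensional para-Kenmotsu manifold, that is, a smooth manifold with a $(1,1)$-tensor field $\phi$, a vector field $\zeta$, a one-form $\eta$ and a semi-Riemannian metric $g$, all smooth, such that $\phi^2 = I - \eta\otimes\zeta$, $\eta(\zeta)=1$, the $\pm1$-eigendistributions of $\phi$ on $\ker\eta$ have equal dimension, $g(\phi X,\phi Y) = -g(X,Y)+\eta(X)\eta(Y)$, $d\eta = 0$, $d\Phi = 2\,\eta\wedge\Phi$ for $\Phi(X,Y)=g(X,\phi Y)$, and the structure is normal (the Nijenhuis tensor $[\phi,\phi]$ vanishes). Let $\nabla$, $S$ and $r$ be the Levi-Civita connection, the Ricci tensor and the scalar curvature of $g$, let $Df$ denote the gradient and $\nabla^2 f(X,Y)=g(\nabla_X Df,Y)$ the Hessian of a function $f$ with respect to $g$, and assume that $r$ is constant on $M$. Let $\alpha,\beta\in\mathbb R$ and let $h, f,\lambda$ be smooth real functions on $M$, with $h$ constant, such that $g$ is an $h$-almost gradient Ricci-Yamabe soliton with potential function $f$: $$h\,\nabla^2 f + \Big(\lambda-\frac{\beta}{2}r\Big)g + \alpha S = 0 .$$ Then $r=-6$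 and $h\,Df = -D\lambda$. Moreover $$\nabla^2(-\lambda) + \Big(\lambda-\frac{\beta}{2}r\Big)g + \alpha S = 0,$$ that is, $g$ is an almost gradient Ricci-Yamabe soliton with potential function $-\lambda$ (and with the same $\lambda,\alpha,\beta$). -/

import Mathlib

open Bundle Manifold VectorField FiberBundle
open scoped ContDiff

noncomputable section

namespace ParaGeom

variable {E : Type*} [NormedAddCommGroup E] [NormedSpace ℝ E]
  {M : Type*} [TopologicalSpace M] [ChartedSpace E M]

/-! ### Tensor fields on a boundaryless manifold `M` modelled on `E` -/

/-- Tangent space of `M` at `x`. -/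
abbrev T (E : Type*) [NormedAddCommGroup E] [NormedSpace ℝ E]
    {M : Type*} [TopologicalSpace M] [ChartedSpace E M] (x : M) : Type _ :=
  TangentSpace 𝓘(ℝ, E) x

/-- Fields of tangent vectors (no regularity imposed). -/
abbrev VField (E : Type*) [NormedAddCommGroup E] [NormedSpace ℝ E]
    (M : Type*) [TopologicalSpace M] [ChartedSpace E M] : Type _ :=
  Π x : M, T E x

/-- Fields of linear forms on the tangent spaces. -/
abbrev OneForm (E : Type*) [NormedAddCommGroup E] [NormedSpace ℝ E]
    (M : Type*) [TopologicalSpace M] [ChartedSpace E M] : Type _ :=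
  Π x : M, T E x →L[ℝ] ℝ

/-- Fields of endomorphisms of the tangent spaces. -/
abbrev EndField (E : Type*) [NormedAddCommGroup E] [NormedSpace ℝ E]
    (M : Type*) [TopologicalSpace M] [ChartedSpace E M] : Type _ :=
  Π x : M, T E x →L[ℝ] T E x

/-- Fields of bilinear forms on the tangent spaces. -/
abbrev BilinField (E : Type*) [NormedAddCommGroup E] [NormedSpace ℝ E]
    (M : Type*) [TopologicalSpace M] [ChartedSpace E M] : Type _ :=
  Π x : M, T E x →L[ℝ] T E x →L[ℝ] ℝ

/-- The derivative `df_x(v)` of a real function in the direction of a tangent vector. -/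
def dir (f : M → ℝ) (x : M) (v : T E x) : ℝ := mvfderiv 𝓘(ℝ, E) f x v

/-- The Lie bracket `[X, Y]`. -/
def lie (X Y : VField E M) : VField E M := fun x ↦ mlieBracket 𝓘(ℝ, E) X Y x

section Smooth

variable [IsManifold 𝓘(ℝ, E) ∞ M]

/-- The vector field `X` is differentiable at `x`. -/
def VDiffAt (X : VField E M) (x : M) : Prop :=
  MDifferentiableAt 𝓘(ℝ, E) (𝓘(ℝ, E).prod 𝓘(ℝ, E)) (fun y ↦ TotalSpace.mk' E y (X y)) x

/-- Smooth vector fields. -/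
def SmoothV (X : VField E M) : Prop :=
  ContMDiff 𝓘(ℝ, E) (𝓘(ℝ, E).prod 𝓘(ℝ, E)) ∞ (fun x ↦ TotalSpace.mk' E x (X x))

/-- Smooth one-forms. -/
def SmoothOneForm (η : OneForm E M) : Prop :=
  ContMDiff 𝓘(ℝ, E) (𝓘(ℝ, E).prod 𝓘(ℝ, E →L[ℝ] ℝ)) ∞
    (fun x ↦ TotalSpace.mk' (E →L[ℝ] ℝ) (E := fun x : M ↦ T E x →L[ℝ] ℝ) x (η x))

/-- Smooth `(1,1)`-tensor fields. -/
def SmoothEnd (φ : EndField E M) : Prop :=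
  ContMDiff 𝓘(ℝ, E) (𝓘(ℝ, E).prod 𝓘(ℝ, E →L[ℝ] E)) ∞
    (fun x ↦ TotalSpace.mk' (E →L[ℝ] E) (E := fun x : M ↦ T E x →L[ℝ] T E x) x (φ x))

/-- Smooth `(0,2)`-tensor fields. -/
def SmoothBilin (g : BilinField E M) : Prop :=
  ContMDiff 𝓘(ℝ, E) (𝓘(ℝ, E).prod 𝓘(ℝ, E →L[ℝ] E →L[ℝ] ℝ)) ∞
    (fun x ↦ TotalSpace.mk' (E →L[ℝ] E →L[ℝ] ℝ)
      (E := fun x : M ↦ T E x →L[ℝ] T E x →L[ℝ] ℝ) x (g x))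

/-- Semi-Riemannian metrics: smooth, symmetric, nondegenerate `(0,2)`-tensor fields. -/
structure IsSemiRiemannian (g : BilinField E M) : Prop where
  smooth : SmoothBilin g
  symm : ∀ (x : M) (v w : T E x), g x v w = g x w v
  nondeg : ∀ (x : M) (v : T E x), (∀ w : T E x, g x v w = 0) → v = 0

/-! ### Levi-Civita connection, curvature, gradient, Hessian -/

/-- The vector `u` with `g(u, v) = ℓ v` for all `v`. It exists and is unique when `g` is
nondegenerate and `ℓ` is linear, the only case in which it is used. -/
def sharp (g : BilinField E M) (x : M) (ℓ : T E x → ℝ) : T E x :=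
  Classical.epsilon fun u : T E x ↦ ∀ v : T E x, g x u v = ℓ v

/-- The right-hand side of the Koszul formula for `2 g(∇_X Y, Z)`. -/
def koszul (g : BilinField E M) (X Y Z : VField E M) (x : M) : ℝ :=
  dir (fun y ↦ g y (Y y) (Z y)) x (X x) + dir (fun y ↦ g y (X y) (Z y)) x (Y x)
    - dir (fun y ↦ g y (X y) (Y y)) x (Z x)
    + g x (lie X Y x) (Z x) - g x (lie X Z x) (Y x) - g x (lie Y Z x) (X x)

/-- The Levi-Civita connection `∇_X Y` of `g`, defined by the Koszul formula. A tangent vector `v`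
at `x` is extended to a vector field near `x` with constant coefficients in the preferred chart;
for `X`, `Y` differentiable at `x` the value does not depend on the extension. -/
def nabla (g : BilinField E M) (X Y : VField E M) : VField E M := fun x ↦
  sharp g x fun v ↦ (1 / 2) * koszul g X Y (extend E v) x

/-- The curvature `R(X, Y) Z = ∇_X ∇_Y Z - ∇_Y ∇_X Z - ∇_[X,Y] Z`. -/
def curvature (g : BilinField E M) (X Y Z : VField E M) : VField E M := fun x ↦
  nabla g X (nabla g Y Z) x - nabla g Y (nabla g X Z) x - nabla g (lie X Y) Z x

/-- The curvature tensor at `x` on tangent vectors, through extensions to vector fields. -/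
def curvatureAt (g : BilinField E M) (x : M) (u v w : T E x) : T E x :=
  curvature g (extend E u) (extend E v) (extend E w) x

/-- The trace of a linear endomorphism `A` of `T_x M`, computed in a basis. -/
def traceAt [FiniteDimensional ℝ E] (x : M) (A : T E x → T E x) : ℝ :=
  ∑ i, (Module.finBasis ℝ E).repr (A (Module.finBasis ℝ E i)) i

/-- The Ricci tensor `S(v, w) = trace (u ↦ R(u, v) w)`. -/
def ricci [FiniteDimensional ℝ E] (g : BilinField E M) (x : M) (v w : T E x) : ℝ :=
  traceAt x fun u ↦ curvatureAt g x u v w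

/-- The Ricci operator `Q`, with `S(v, w) = g(Q v, w)`. -/
def ricciOp [FiniteDimensional ℝ E] (g : BilinField E M) (x : M) (v : T E x) : T E x :=
  sharp g x (ricci g x v)

/-- The scalar curvature `r = trace Q`. -/
def scal [FiniteDimensional ℝ E] (g : BilinField E M) (x : M) : ℝ := traceAt x (ricciOp g x)

/-- The gradient `Df`, with `g(Df, v) = df(v)`. -/
def grad (g : BilinField E M) (f : M → ℝ) : VField E M := fun x ↦ sharp g x (dir f x)

/-- The Hessian `∇²f (v, w) = g(∇_v Df, w)`. -/
def hess (g : BilinField E M) (f : M → ℝ) (x : M) (v w : T E x) : ℝ :=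
  g x (nabla g (extend E v) (grad g f) x) w

/-! ### Almost paracontact metric structures and para-Kenmotsu manifolds -/

/-- `dη(X, Y) = X η(Y) - Y η(X) - η([X, Y])`. -/
def extDerivOne (η : OneForm E M) (X Y : VField E M) (x : M) : ℝ :=
  dir (fun y ↦ η y (Y y)) x (X x) - dir (fun y ↦ η y (X y)) x (Y x) - η x (lie X Y x)

/-- `dΨ(X, Y, Z)`, the cyclic sum of `X Ψ(Y, Z) - Ψ([X, Y], Z)`, for a two-form `Ψ`. -/
def extDerivTwo (Ψ : Π x : M, T E x → T E x → ℝ) (X Y Z : VField E M) (x : M) : ℝ :=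
  dir (fun y ↦ Ψ y (Y y) (Z y)) x (X x) + dir (fun y ↦ Ψ y (Z y) (X y)) x (Y x)
    + dir (fun y ↦ Ψ y (X y) (Y y)) x (Z x)
    - Ψ x (lie X Y x) (Z x) - Ψ x (lie Y Z x) (X x) - Ψ x (lie Z X x) (Y x)

/-- `(η ∧ Ψ)(u, v, w)` for a one-form `η` and a two-form `Ψ`, in the normalization of
`extDerivTwo`. -/
def wedgeOneTwo (η : OneForm E M) (Ψ : Π x : M, T E x → T E x → ℝ) (x : M)
    (u v w : T E x) : ℝ :=
  η x u * Ψ x v w + η x v * Ψ x w u + η x w * Ψ x u v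

/-- The fundamental two-form `Φ(v, w) = g(v, φ w)`. -/
def fundForm (φ : EndField E M) (g : BilinField E M) (x : M) (v w : T E x) : ℝ :=
  g x v (φ x w)

/-- The Nijenhuis torsion
`[φ, φ](X, Y) = φ²[X, Y] + [φX, φY] - φ[φX, Y] - φ[X, φY]`. -/
def nijenhuis (φ : EndField E M) (X Y : VField E M) (x : M) : T E x :=
  φ x (φ x (lie X Y x)) + lie (fun y ↦ φ y (X y)) (fun y ↦ φ y (Y y)) x
    - φ x (lie (fun y ↦ φ y (X y)) Y x) - φ x (lie X (fun y ↦ φ y (Y y)) x)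

/-- Almost paracontact structures `(φ, ζ, η)`. The eigenspaces of `φ` for `±1` lie in `ker η`. -/
structure IsAlmostParacontact (φ : EndField E M) (ζ : VField E M) (η : OneForm E M) : Prop where
  smooth_phi : SmoothEnd φ
  smooth_zeta : SmoothV ζ
  smooth_eta : SmoothOneForm η
  phi_sq : ∀ (x : M) (v : T E x), φ x (φ x v) = v - η x v • ζ x
  eta_zeta : ∀ x : M, η x (ζ x) = 1
  finrank_eigenspace : ∀ x : M,
    Module.finrank ℝ (Module.End.eigenspace (φ x : T E x →ₗ[ℝ] T E x) 1) =
      Module.finrank ℝ (Module.End.eigenspace (φ x : T E x →ₗ[ℝ] T E x) (-1))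

/-- Almost paracontact metric structures `(φ, ζ, η, g)`. -/
structure IsAlmostParacontactMetric (φ : EndField E M) (ζ : VField E M) (η : OneForm E M)
    (g : BilinField E M) : Prop where
  paracontact : IsAlmostParacontact φ ζ η
  metric : IsSemiRiemannian g
  compat : ∀ (x : M) (v w : T E x), g x (φ x v) (φ x w) = -g x v w + η x v * η x w

/-- Normality: `[φ, φ] = dη ⊗ ζ`. (With the convention in which `dη` carries a factor `1/2`
this reads `[φ, φ] = 2 dη ⊗ ζ`; if `dη = 0` it says `[φ, φ] = 0`.) -/
def IsNormal (φ : EndField E M) (ζ : VField E M) (η : OneForm E M) : Prop :=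
  ∀ (x : M) (X Y : VField E M), VDiffAt X x → VDiffAt Y x →
    nijenhuis φ X Y x = extDerivOne η X Y x • ζ x

/-- Almost para-Kenmotsu structures: `dη = 0` and `dΦ = 2 η ∧ Φ`. -/
structure IsAlmostParaKenmotsu (φ : EndField E M) (ζ : VField E M) (η : OneForm E M)
    (g : BilinField E M) : Prop where
  paracontactMetric : IsAlmostParacontactMetric φ ζ η g
  closed_eta : ∀ (x : M) (X Y : VField E M), VDiffAt X x → VDiffAt Y x →
    extDerivOne η X Y x = 0
  deriv_fundForm : ∀ (x : M) (X Y Z : VField E M), VDiffAt X x → VDiffAt Y x → VDiffAt Z x →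
    extDerivTwo (fundForm φ g) X Y Z x = 2 * wedgeOneTwo η (fundForm φ g) x (X x) (Y x) (Z x)

/-- Para-Kenmotsu structures: normal almost para-Kenmotsu structures. -/
structure IsParaKenmotsu (φ : EndField E M) (ζ : VField E M) (η : OneForm E M)
    (g : BilinField E M) : Prop where
  almost : IsAlmostParaKenmotsu φ ζ η g
  normal : IsNormal φ ζ η

/-! ### Solitons -/

/-- `h`-almost gradient Ricci-Yamabe soliton with potential function `f` and soliton function
`lam`: `h ∇²f + (lam - (β/2) r) g + α S = 0`. -/
structure IsHAlmostGradientRYSoliton [FiniteDimensional ℝ E] (g : BilinField E M)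
    (h f lam : M → ℝ) (α β : ℝ) : Prop where
  smooth_h : ContMDiff 𝓘(ℝ, E) 𝓘(ℝ, ℝ) ∞ h
  smooth_potential : ContMDiff 𝓘(ℝ, E) 𝓘(ℝ, ℝ) ∞ f
  smooth_lam : ContMDiff 𝓘(ℝ, E) 𝓘(ℝ, ℝ) ∞ lam
  eqn : ∀ (x : M) (v w : T E x),
    h x * hess g f x v w + (lam x - β / 2 * scal g x) * g x v w + α * ricci g x v w = 0

/-- Almost gradient Ricci-Yamabe soliton with potential function `f` and soliton function `lam`:
`∇²f + (lam - (β/2) r) g + α S = 0`. -/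
structure IsAlmostGradientRYSoliton [FiniteDimensional ℝ E] (g : BilinField E M)
    (f lam : M → ℝ) (α β : ℝ) : Prop where
  smooth_potential : ContMDiff 𝓘(ℝ, E) 𝓘(ℝ, ℝ) ∞ f
  smooth_lam : ContMDiff 𝓘(ℝ, E) 𝓘(ℝ, ℝ) ∞ lam
  eqn : ∀ (x : M) (v w : T E x),
    hess g f x v w + (lam x - β / 2 * scal g x) * g x v w + α * ricci g x v w = 0

end Smooth

end ParaGeom

end

/-! The proof shows that constant scalar curvature forces constant curvature $-1$, and then that the
soliton equation leaves no freedom.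

Normality and $d\Phi = 2\eta\wedge\Phi$ give $L_\zeta g = 2(g-\eta\otimes\eta)$ (`lieDeriv_metric`).
Together with $d\eta=0$ and the Koszul formula this yields $\nabla_X\zeta = X-\eta(X)\zeta$
(`nabla_zeta`), hence $R(X,Y)\zeta = \eta(X)Y-\eta(Y)X$ (`curvature_zeta`). In dimension three the
symmetries of $R$ leave one unknown at each point, the component along the plane $\ker\eta$, so $R$
is a `modelCurvature` with parameter $k$ (`exists_curvatureAt_eq`), and taking traces gives
$r=-6+2k$ (`scal_eq`). If $r$ is constant, so is $k$; the second Bianchi identity on $\zeta$ and two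
fields in $\ker\eta$ then reduces to $2k$ times a nonzero vector being zero
(`bianchi_modelCurvature`). So $k=0$, $r=-6$ and $S=-2g$.

The soliton equation becomes $h\nabla^2 f=-\mu g$ with $\mu=\lambda+3\beta-2\alpha$, that is
$h\nabla_X Df=-\mu X$. Computing $hR(X,Y)Df$ from this and from the constant curvature gives
$(h\,Yf+Y\mu)X=(h\,Xf+X\mu)Y$. Taking $X$ independent of $Y$ gives $h\,df=-d\mu=-d\lambda$
(`grad_of_hess_eq`). Hence $D(-\lambda)=h\,Df$, so $\nabla^2(-\lambda)=h\nabla^2f$. There is no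
division by $h$, so $h=0$ is covered.

Since the definitions use local extensions `extend E v`, a preliminary stage shows that the Koszul
connection and the curvature are tensorial where expected, so that they can be computed with global
smooth fields. -/

noncomputable section

namespace ParaGeom

open Filter Topology

variable {E : Type*} [NormedAddCommGroup E] [NormedSpace ℝ E]
  {M : Type*} [TopologicalSpace M] [ChartedSpace E M]

/-! ### Smooth functions and smooth vector fields -/

/-- Smooth real functions. -/
abbrev SmoothF (E : Type*) [NormedAddCommGroup E] [NormedSpace ℝ E]
    {M : Type*} [TopologicalSpace M] [ChartedSpace E M] (f : M → ℝ) : Prop :=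
  ContMDiff 𝓘(ℝ, E) 𝓘(ℝ, ℝ) ∞ f

/-- The function `X f`. -/
abbrev der (X : VField E M) (f : M → ℝ) : M → ℝ := fun y ↦ dir f y (X y)

lemma SmoothF.mdiff {f : M → ℝ} (hf : SmoothF E f) (x : M) :
    MDifferentiableAt 𝓘(ℝ, E) 𝓘(ℝ, ℝ) f x :=
  hf.contMDiffAt.mdifferentiableAt (by simp)

section dir

variable {f g : M → ℝ} {x : M} {v w : T E x}

lemma dir_vadd : dir f x (v + w) = dir f x v + dir f x w := map_add _ _ _

lemma dir_vsmul (c : ℝ) : dir f x (c • v) = c * dir f x v := map_smul _ _ _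

lemma dir_vzero : dir f x (0 : T E x) = 0 := map_zero _

lemma dir_add (hf : MDifferentiableAt 𝓘(ℝ, E) 𝓘(ℝ, ℝ) f x)
    (hg : MDifferentiableAt 𝓘(ℝ, E) 𝓘(ℝ, ℝ) g x) :
    dir (fun y ↦ f y + g y) x v = dir f x v + dir g x v := by
  simp [dir, mvfderiv_fun_add hf hg]

lemma dir_neg : dir (fun y ↦ -f y) x v = -dir f x v := by
  simp [dir, mvfderiv_fun_neg]

lemma dir_mul (hf : MDifferentiableAt 𝓘(ℝ, E) 𝓘(ℝ, ℝ) f x)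
    (hg : MDifferentiableAt 𝓘(ℝ, E) 𝓘(ℝ, ℝ) g x) :
    dir (fun y ↦ f y * g y) x v = f x * dir g x v + g x * dir f x v := by
  simp [dir, mvfderiv_fun_mul hf hg]

lemma dir_const (c : ℝ) : dir (fun _ : M ↦ c) x v = 0 := by
  simp [dir, mvfderiv_const]

lemma dir_congr (h : f =ᶠ[𝓝 x] g) : dir f x v = dir g x v := by
  simp only [dir, mvfderiv, h.mfderiv_eq]
  rfl

end dir

variable [IsManifold 𝓘(ℝ, E) ∞ M]

lemma isManifold_minSmoothness (n : ℕ) : IsManifold 𝓘(ℝ, E) (minSmoothness ℝ n) M := by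
  rw [minSmoothness_of_isRCLikeNormedField]
  infer_instance

instance isManifold_minSmoothness_two : IsManifold 𝓘(ℝ, E) (minSmoothness ℝ 2) M :=
  isManifold_minSmoothness 2

instance isManifold_minSmoothness_three : IsManifold 𝓘(ℝ, E) (minSmoothness ℝ 3) M :=
  isManifold_minSmoothness 3

lemma SmoothV.vdiff {X : VField E M} (hX : SmoothV X) (x : M) : VDiffAt X x :=
  hX.contMDiffAt.mdifferentiableAt (by simp)

section algebra

variable {X Y : VField E M} {f : M → ℝ}

lemma SmoothV.add (hX : SmoothV X) (hY : SmoothV Y) : SmoothV (X + Y) :=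
  ContMDiff.add_section hX hY

lemma SmoothV.sub (hX : SmoothV X) (hY : SmoothV Y) : SmoothV (X - Y) :=
  ContMDiff.sub_section hX hY

lemma SmoothV.neg (hX : SmoothV X) : SmoothV (-X) := ContMDiff.neg_section hX

lemma SmoothV.smul (hf : SmoothF E f) (hX : SmoothV X) : SmoothV (f • X) :=
  ContMDiff.smul_section hf hX

lemma SmoothV.sum {ι : Type*} {s : Finset ι} {X : ι → VField E M}
    (hX : ∀ i ∈ s, SmoothV (X i)) : SmoothV (fun x ↦ ∑ i ∈ s, X i x) :=
  ContMDiff.sum_section hX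

lemma smoothV_zero : SmoothV (0 : VField E M) :=
  contMDiff_zeroSection ℝ (fun x : M ↦ T E x)

lemma VDiffAt.add {x : M} (hX : VDiffAt X x) (hY : VDiffAt Y x) : VDiffAt (X + Y) x :=
  mdifferentiableAt_add_section hX hY

lemma VDiffAt.smul {x : M} (hf : MDifferentiableAt 𝓘(ℝ, E) 𝓘(ℝ, ℝ) f x) (hX : VDiffAt X x) :
    VDiffAt (f • X) x :=
  MDifferentiableAt.smul_section hf hX

lemma vdiff_extend {x : M} (v : T E x) : VDiffAt (extend E v) x :=
  mdifferentiableAt_extend ..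

lemma SmoothOneForm.apply {η : OneForm E M} (hη : SmoothOneForm η) (hX : SmoothV X) :
    SmoothF E (fun x ↦ η x (X x)) := by
  have : ContMDiff 𝓘(ℝ, E) (𝓘(ℝ, E).prod 𝓘(ℝ, ℝ)) ∞
      (fun x ↦ TotalSpace.mk' ℝ (E := Bundle.Trivial M ℝ) x (η x (X x))) :=
    ContMDiff.clm_bundle_apply (F₁ := E) (F₂ := ℝ) (E₁ := fun x : M ↦ T E x)
      (E₂ := Bundle.Trivial M ℝ) hη hX
  intro x
  have := this x
  rw [contMDiffAt_totalSpace] at this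
  exact this.2

lemma SmoothEnd.apply {φ : EndField E M} (hφ : SmoothEnd φ) (hX : SmoothV X) :
    SmoothV (fun x ↦ φ x (X x)) :=
  ContMDiff.clm_bundle_apply (F₁ := E) (F₂ := E) (E₁ := fun x : M ↦ T E x)
      (E₂ := fun x : M ↦ T E x) hφ hX

lemma SmoothBilin.contMDiffAt_apply {g : BilinField E M} (hg : SmoothBilin g) {x : M}
    (hX : ContMDiffAt 𝓘(ℝ, E) (𝓘(ℝ, E).prod 𝓘(ℝ, E)) ∞ (fun x ↦ TotalSpace.mk' E x (X x)) x)
    (hY : ContMDiffAt 𝓘(ℝ, E) (𝓘(ℝ, E).prod 𝓘(ℝ, E)) ∞ (fun x ↦ TotalSpace.mk' E x (Y x)) x) :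
    ContMDiffAt 𝓘(ℝ, E) 𝓘(ℝ, ℝ) ∞ (fun x ↦ g x (X x) (Y x)) x := by
  have : ContMDiffAt 𝓘(ℝ, E) (𝓘(ℝ, E).prod 𝓘(ℝ, ℝ)) ∞
      (fun x ↦ TotalSpace.mk' ℝ (E := Bundle.Trivial M ℝ) x (g x (X x) (Y x))) x :=
    ContMDiffAt.clm_bundle_apply₂ (F₁ := E) (F₂ := E) (F₃ := ℝ) (E₁ := fun x : M ↦ T E x)
      (E₂ := fun x : M ↦ T E x) (E₃ := Bundle.Trivial M ℝ) hg.contMDiffAt hX hY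
  rw [contMDiffAt_totalSpace] at this
  exact this.2

lemma SmoothBilin.apply {g : BilinField E M} (hg : SmoothBilin g) (hX : SmoothV X)
    (hY : SmoothV Y) : SmoothF E (fun x ↦ g x (X x) (Y x)) :=
  fun _ ↦ hg.contMDiffAt_apply hX.contMDiffAt hY.contMDiffAt

lemma SmoothBilin.mdiff_apply {g : BilinField E M} (hg : SmoothBilin g) {x : M}
    (hX : VDiffAt X x) (hY : VDiffAt Y x) :
    MDifferentiableAt 𝓘(ℝ, E) 𝓘(ℝ, ℝ) (fun x ↦ g x (X x) (Y x)) x := by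
  have : MDifferentiableAt 𝓘(ℝ, E) (𝓘(ℝ, E).prod 𝓘(ℝ, ℝ))
      (fun x ↦ TotalSpace.mk' ℝ (E := Bundle.Trivial M ℝ) x (g x (X x) (Y x))) x :=
    MDifferentiableAt.clm_bundle_apply₂ (F₁ := E) (F₂ := E) (F₃ := ℝ) (E₁ := fun x : M ↦ T E x)
      (E₂ := fun x : M ↦ T E x) (E₃ := Bundle.Trivial M ℝ)
      (hg.contMDiffAt.mdifferentiableAt (by simp)) hX hY
  rw [mdifferentiableAt_totalSpace] at this
  exact this.2

lemma SmoothF.der (hf : SmoothF E f) (hX : SmoothV X) : SmoothF E (der X f) := by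
  have h1 : ContMDiff 𝓘(ℝ, E).tangent 𝓘(ℝ, ℝ).tangent ∞ (tangentMap 𝓘(ℝ, E) 𝓘(ℝ, ℝ) f) :=
    hf.contMDiff_tangentMap (by simp)
  exact (contMDiff_snd_tangentBundle_modelSpace ℝ 𝓘(ℝ, ℝ)).comp (h1.comp hX)

lemma SmoothV.lie [CompleteSpace E] (hX : SmoothV X) (hY : SmoothV Y) : SmoothV (lie X Y) := by
  intro x
  have : IsManifold 𝓘(ℝ, E) ((⊤ : ℕ∞) + 1) M := inferInstanceAs (IsManifold 𝓘(ℝ, E) ∞ M)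
  exact ContMDiffAt.mlieBracket_vectorField (m := ⊤) (n := ⊤) hX.contMDiffAt hY.contMDiffAt
    (by simp)

end algebra

end ParaGeom

end

noncomputable section

namespace ParaGeom

open Filter Topology

variable {E : Type*} [NormedAddCommGroup E] [NormedSpace ℝ E]
  {M : Type*} [TopologicalSpace M] [ChartedSpace E M]

/-! ### The Lie bracket -/

section lie

variable {X Y Z : VField E M} {f : M → ℝ} {x : M}

lemma lie_swap (X Y : VField E M) (x : M) : lie X Y x = -lie Y X x := mlieBracket_swap_apply

lemma lie_swap' (X Y : VField E M) : lie X Y = -lie Y X := mlieBracket_swap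

lemma lie_congr {X' Y' : VField E M} (hX : ∀ᶠ y in 𝓝 x, X y = X' y)
    (hY : ∀ᶠ y in 𝓝 x, Y y = Y' y) : lie X Y x = lie X' Y' x :=
  EventuallyEq.mlieBracket_vectorField_eq hX hY

variable [IsManifold 𝓘(ℝ, E) ∞ M] [CompleteSpace E]

lemma lie_add_left (hX : VDiffAt X x) (hY : VDiffAt Y x) :
    lie (X + Y) Z x = lie X Z x + lie Y Z x := mlieBracket_add_left hX hY

lemma lie_add_right (hX : VDiffAt X x) (hY : VDiffAt Y x) :
    lie Z (X + Y) x = lie Z X x + lie Z Y x := mlieBracket_add_right hX hY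

lemma lie_smul_left (hf : MDifferentiableAt 𝓘(ℝ, E) 𝓘(ℝ, ℝ) f x) (hX : VDiffAt X x) :
    lie (f • X) Y x = -dir f x (Y x) • X x + f x • lie X Y x := mlieBracket_smul_left hf hX

lemma lie_smul_right (hf : MDifferentiableAt 𝓘(ℝ, E) 𝓘(ℝ, ℝ) f x) (hY : VDiffAt Y x) :
    lie X (f • Y) x = dir f x (X x) • Y x + f x • lie X Y x := mlieBracket_smul_right hf hY

lemma lie_neg_right (hY : VDiffAt Y x) : lie X (-Y) x = -lie X Y x := by
  have h := lie_smul_right (X := X) (f := fun _ ↦ (-1 : ℝ)) mdifferentiableAt_const hY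
  rw [dir_const, zero_smul, zero_add, neg_one_smul] at h
  rw [← h]
  congr 1
  ext1 y
  simp

lemma lie_jacobi (hX : SmoothV X) (hY : SmoothV Y) (hZ : SmoothV Z) (x : M) :
    lie X (lie Y Z) x = lie (lie X Y) Z x + lie Y (lie X Z) x := by
  have h2 : minSmoothness ℝ 2 ≤ ∞ := by
    rw [minSmoothness_of_isRCLikeNormedField]; exact ENat.LEInfty.out
  exact leibniz_identity_mlieBracket_apply ((hX x).of_le h2) ((hY x).of_le h2) ((hZ x).of_le h2)

end lie

/-! ### Extension of tangent vectors and local frames -/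

variable [IsManifold 𝓘(ℝ, E) ∞ M] [FiniteDimensional ℝ E] [T2Space M]

lemma exists_bump {x : M} {s : Set M} (hs : s ∈ 𝓝 x) :
    ∃ ψ : M → ℝ, SmoothF E ψ ∧ tsupport ψ ⊆ s ∧ ψ =ᶠ[𝓝 x] 1 := by
  obtain ⟨ψ, hψ⟩ := (SmoothBumpFunction.nhds_basis_tsupport (I := 𝓘(ℝ, E)) x).mem_iff.1 hs
  exact ⟨ψ, ψ.contMDiff, hψ.2, ψ.eventuallyEq_one⟩

/-- The field `extend E v` is known to be smooth only near `x`. Cutting it off with a bump function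
gives a global smooth field with the same germ, which is all that the bracket, the connection and
the curvature see. -/
lemma exists_smoothV_eventuallyEq_extend {x : M} (v : T E x) :
    ∃ X : VField E M, SmoothV X ∧ ∀ᶠ y in 𝓝 x, X y = (extend E v : VField E M) y := by
  obtain ⟨s, hs, hsv⟩ := exists_contMDiffOn_extend (k := ∞) 𝓘(ℝ, E) E v
  obtain ⟨ψ, hψ, hψs, hψ1⟩ := exists_bump (E := E) (interior_mem_nhds.2 hs)
  refine ⟨ψ • (extend E v : VField E M), ContMDiffOn.smul_section_of_tsupport hψ.contMDiffOn isOpen_interior hψs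
    (hsv.mono interior_subset), ?_⟩
  filter_upwards [hψ1] with y hy
  simp [hy]

lemma exists_smoothV_apply_eq {x : M} (v : T E x) :
    ∃ X : VField E M, SmoothV X ∧ X x = v := by
  obtain ⟨X, hX, h⟩ := exists_smoothV_eventuallyEq_extend v
  exact ⟨X, hX, h.self_of_nhds.trans (extend_apply_self E v)⟩

/-- Every operation on smooth vector fields which is additive and linear over smooth functions
at `x` only depends on the value at `x`. -/
lemma eq_of_smooth_linear {A : Type*} [AddCommGroup A] [Module ℝ A] {x : M} {Φ : VField E M → A}
    (hadd : ∀ X Y, SmoothV X → SmoothV Y → Φ (X + Y) = Φ X + Φ Y)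
    (hsmul : ∀ (f : M → ℝ) X, SmoothF E f → SmoothV X → Φ (f • X) = f x • Φ X)
    {X Y : VField E M} (hX : SmoothV X) (hY : SmoothV Y) (h : X x = Y x) : Φ X = Φ Y := by
  classical
  have hzero : Φ 0 = 0 := by
    have := hadd 0 0 smoothV_zero smoothV_zero
    simpa using this
  have hsum : ∀ (s : Finset (Fin (Module.finrank ℝ E))) (Z : Fin (Module.finrank ℝ E) → VField E M),
      (∀ i, SmoothV (Z i)) → Φ (fun y ↦ ∑ i ∈ s, Z i y) = ∑ i ∈ s, Φ (Z i) := by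
    intro s Z hZ
    induction s using Finset.induction_on with
    | empty => simpa using! hzero
    | insert a s ha ih =>
      rw [Finset.sum_insert ha, ← ih, ← hadd _ _ (hZ a) (SmoothV.sum fun i _ ↦ hZ i)]
      congr 1
      ext1 y
      exact Finset.sum_insert ha
  suffices H : ∀ Z : VField E M, SmoothV Z → Z x = 0 → Φ Z = 0 by
    have h1 := H (X - Y) (hX.sub hY) (by simp [h])
    have h2 := hadd (X - Y) Y (hX.sub hY) hY
    simpa [h1] using h2
  intro Z hZ hZx
  let t := trivializationAt E (fun y : M ↦ T E y) x
  have xt : x ∈ t.baseSet := FiberBundle.mem_baseSet_trivializationAt E (fun y : M ↦ T E y) x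
  let b := Module.finBasis ℝ E
  let s := t.localFrame b
  let c := fun i y ↦ t.localFrameCoeff 𝓘(ℝ, E) b i y (Z y)
  obtain ⟨ψ, hψ, hψs, hψ1⟩ := exists_bump (E := E) (t.open_baseSet.mem_nhds xt)
  have hs : ∀ i, SmoothV (ψ • s i) := fun i ↦
    ContMDiffOn.smul_section_of_tsupport hψ.contMDiffOn t.open_baseSet hψs
      (t.contMDiffOn_localFrame_baseSet ∞ b i)
  have hc : ∀ i, SmoothF E (fun y ↦ ψ y * c i y) := by
    intro i
    refine contMDiff_of_tsupport fun y hy ↦ ?_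
    have hy' : y ∈ t.baseSet := hψs (closure_mono (fun z hz ↦ left_ne_zero_of_mul hz) hy)
    exact hψ.contMDiffAt.mul (contMDiffAt_localFrameCoeff b hy' (hZ y) i)
  have hsm : SmoothF E (fun y ↦ 1 - ψ y * ψ y) := contMDiff_const.sub (hψ.mul hψ)
  -- Localization with global coefficients: the factor $1-\psi^2$ vanishes at `x`, and one $\psi$
  -- goes to the frame fields and one to the coefficients so that both become globally smooth. All
  -- the scalar factors are then zero at `x`.
  have key : Z = (fun y ↦ 1 - ψ y * ψ y) • Z
      + fun y ↦ ∑ i, ((fun y ↦ ψ y * c i y) • (ψ • s i)) y := by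
    ext1 y
    by_cases hy : y ∈ t.baseSet
    · have h1 : Z y = ∑ i, c i y • s i y := t.eq_sum_localFrameCoeff_smul (I := 𝓘(ℝ, E)) hy
      have h2 : ∑ i, (ψ y * c i y) • ψ y • s i y = (ψ y * ψ y) • Z y := by
        rw [h1, Finset.smul_sum]
        refine Finset.sum_congr rfl fun i _ ↦ ?_
        module
      simp only [Pi.add_apply, Pi.smul_apply', h2]
      module
    · have : ψ y = 0 := by
        by_contra h0
        exact hy (hψs (subset_closure h0))
      simp [this]
  have hx1 : ψ x = 1 := hψ1.self_of_nhds
  rw [key, hadd _ _ (SmoothV.smul hsm hZ) (SmoothV.sum fun i _ ↦ SmoothV.smul (hc i) (hs i)),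
    hsum _ _ fun i ↦ SmoothV.smul (hc i) (hs i), hsmul _ _ hsm hZ]
  have hcx : ∀ i, c i x = 0 := fun i ↦ by simp only [c, hZx, map_zero]
  simp only [hx1, mul_one, sub_self, zero_smul, zero_add]
  refine Finset.sum_eq_zero fun i _ ↦ ?_
  rw [hsmul _ _ (hc i) (hs i), hcx, mul_zero, zero_smul]

lemma exists_smooth_frame (x : M) :
    ∃ S : Fin (Module.finrank ℝ E) → VField E M, (∀ i, SmoothV (S i)) ∧
      ∀ᶠ y in 𝓝 x, ∃ b : Module.Basis (Fin (Module.finrank ℝ E)) ℝ (T E y), ∀ i, b i = S i y := by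
  let t := trivializationAt E (fun y : M ↦ T E y) x
  have xt : x ∈ t.baseSet := FiberBundle.mem_baseSet_trivializationAt E (fun y : M ↦ T E y) x
  let b := Module.finBasis ℝ E
  obtain ⟨ψ, hψ, hψs, hψ1⟩ := exists_bump (E := E) (t.open_baseSet.mem_nhds xt)
  refine ⟨fun i ↦ ψ • t.localFrame b i, fun i ↦
    ContMDiffOn.smul_section_of_tsupport hψ.contMDiffOn t.open_baseSet hψs
      (t.contMDiffOn_localFrame_baseSet ∞ b i), ?_⟩
  filter_upwards [hψ1, t.open_baseSet.mem_nhds xt] with y hy hyt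
  exact ⟨t.basisAt b hyt, fun i ↦ by simp [hy, hyt]⟩

/-- The derivation `[X, Y]` is the commutator of the derivations `X` and `Y`. -/
lemma dir_lie {X Y : VField E M} {f : M → ℝ} (hX : SmoothV X) (hY : SmoothV Y)
    (hf : SmoothF E f) (x : M) :
    dir f x (lie X Y x) = dir (der Y f) x (X x) - dir (der X f) x (Y x) := by
  have : CompleteSpace E := FiniteDimensional.complete ℝ E
  -- The Jacobi identity for $X$, $Y$, $fZ$ minus $f$ times that for $X$, $Y$, $Z$ leaves $([X,Y]f -
  -- X(Yf) + Y(Xf))Z = 0$. A field with $Z_x\ne0$ concludes; in a zero tangent space both sides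
  -- vanish.
  by_cases hE : ∃ v : T E x, v ≠ 0
  · obtain ⟨v, hv⟩ := hE
    obtain ⟨Z, hZ, hZx⟩ := exists_smoothV_apply_eq v
    have h1 : ∀ W : VField E M, SmoothV W → lie W (f • Z) = der W f • Z + f • lie W Z := by
      intro W hW
      ext1 y
      exact lie_smul_right (hf.mdiff y) (hZ.vdiff y)
    have key := lie_jacobi hX hY (SmoothV.smul hf hZ) x
    rw [h1 Y hY, h1 X hX, lie_add_right ((SmoothV.smul (hf.der hY) hZ).vdiff x)
        ((SmoothV.smul hf (hY.lie hZ)).vdiff x),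
      lie_add_right ((SmoothV.smul (hf.der hX) hZ).vdiff x)
        ((SmoothV.smul hf (hX.lie hZ)).vdiff x),
      lie_smul_right ((hf.der hY).mdiff x) (hZ.vdiff x),
      lie_smul_right ((hf.der hX).mdiff x) (hZ.vdiff x),
      lie_smul_right (hf.mdiff x) ((hY.lie hZ).vdiff x),
      lie_smul_right (hf.mdiff x) ((hX.lie hZ).vdiff x),
      lie_smul_right (hf.mdiff x) (hZ.vdiff x), lie_jacobi hX hY hZ x] at key
    have h2 : (dir f x (lie X Y x) - (dir (der Y f) x (X x) - dir (der X f) x (Y x))) • Z x = 0 := by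
      rw [sub_smul, sub_smul, sub_eq_zero]
      rw [smul_add] at key
      linear_combination (norm := module) -key
    rw [hZx] at h2
    exact sub_eq_zero.1 ((smul_eq_zero.1 h2).resolve_right hv)
  · push Not at hE
    rw [hE (X x), hE (Y x), hE (lie X Y x)]
    simp [dir_vzero]

end ParaGeom

end

noncomputable section

namespace ParaGeom

open Filter Topology

variable {E : Type*} [NormedAddCommGroup E] [NormedSpace ℝ E]
  {M : Type*} [TopologicalSpace M] [ChartedSpace E M]

/-! ### The Levi-Civita connection -/

lemma contMDiffAt_det {ι : Type*} [Fintype ι] [DecidableEq ι] {A : M → Matrix ι ι ℝ} {x : M}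
    (hA : ∀ i j, ContMDiffAt 𝓘(ℝ, E) 𝓘(ℝ, ℝ) ∞ (fun y ↦ A y i j) x) :
    ContMDiffAt 𝓘(ℝ, E) 𝓘(ℝ, ℝ) ∞ (fun y ↦ (A y).det) x := by
  simp only [Matrix.det_apply, Units.smul_def, zsmul_eq_mul]
  exact ContMDiffAt.sum fun σ _ ↦ contMDiffAt_const.mul (ContMDiffAt.prod fun i _ ↦ hA _ _)

variable [IsManifold 𝓘(ℝ, E) ∞ M]

lemma nabla_congr {g : BilinField E M} {X X' Y Y' : VField E M} {x : M} (hX : ∀ᶠ y in 𝓝 x, X y = X' y)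
    (hY : ∀ᶠ y in 𝓝 x, Y y = Y' y) : nabla g X Y x = nabla g X' Y' x := by
  have h1 : ∀ v : T E x, koszul g X Y (extend E v) x = koszul g X' Y' (extend E v) x := by
    intro v
    have hR : ∀ᶠ y in 𝓝 x, (extend E v : VField E M) y = (extend E v : VField E M) y :=
      Eventually.of_forall fun _ ↦ rfl
    unfold koszul
    rw [lie_congr hX hY, lie_congr hX hR, lie_congr hY hR, hX.self_of_nhds, hY.self_of_nhds]
    have h1 : (fun y ↦ g y (Y y) (extend E v y)) =ᶠ[𝓝 x] fun y ↦ g y (Y' y) (extend E v y) :=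
      hY.mono fun y hy ↦ by simp only [hy]
    have h2 : (fun y ↦ g y (X y) (extend E v y)) =ᶠ[𝓝 x] fun y ↦ g y (X' y) (extend E v y) :=
      hX.mono fun y hy ↦ by simp only [hy]
    have h3 : (fun y ↦ g y (X y) (Y y)) =ᶠ[𝓝 x] fun y ↦ g y (X' y) (Y' y) :=
      (hX.and hY).mono fun y hy ↦ by simp only [hy.1, hy.2]
    rw [dir_congr h1, dir_congr h2, dir_congr h3]
  simp only [nabla, h1]

lemma IsSemiRiemannian.ext {g : BilinField E M} (hg : IsSemiRiemannian g) {x : M} {u v : T E x} (h : ∀ w : T E x, g x u w = g x v w) : u = v :=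
  sub_eq_zero.1 (hg.nondeg x _ fun w ↦ by simp [h w])

/-- Vectors at `x` are equal if they have the same products with all differentiable fields. -/
lemma IsSemiRiemannian.ext_field {g : BilinField E M} (hg : IsSemiRiemannian g) {x : M} {u v : T E x} (h : ∀ W : VField E M, VDiffAt W x →
    g x u (W x) = g x v (W x)) : u = v := by
  refine hg.ext fun w ↦ ?_
  simpa using h (extend E w) (vdiff_extend w)

variable [FiniteDimensional ℝ E]

instance finiteDimensional_tangentSpace (x : M) : FiniteDimensional ℝ (T E x) :=
  inferInstanceAs (FiniteDimensional ℝ E)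

instance completeSpace_model : CompleteSpace E := FiniteDimensional.complete ℝ E

namespace IsSemiRiemannian

variable {g : BilinField E M} (hg : IsSemiRiemannian g)

include hg

/-- Nondegeneracy makes $u\mapsto g(u,\cdot)$ injective into the dual, hence surjective by
dimension, so the choice in `sharp` has a witness. -/
lemma sharp_spec {x : M} (l : T E x →ₗ[ℝ] ℝ) (v : T E x) : g x (sharp g x l) v = l v := by
  let B : T E x →ₗ[ℝ] Module.Dual ℝ (T E x) :=
    (ContinuousLinearMap.coeLM ℝ).comp (g x : T E x →ₗ[ℝ] T E x →L[ℝ] ℝ)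
  have hB : Function.Injective B := by
    rw [injective_iff_map_eq_zero]
    exact fun u hu ↦ hg.nondeg x u fun w ↦ LinearMap.congr_fun hu w
  have hB' : Function.Surjective B :=
    (LinearMap.injective_iff_surjective_of_finrank_eq_finrank
      Subspace.dual_finrank_eq.symm).1 hB
  obtain ⟨u, hu⟩ := hB' l
  have hex : ∃ u : T E x, ∀ v, g x u v = l v := ⟨u, fun v ↦ LinearMap.congr_fun hu v⟩
  exact Classical.epsilon_spec hex v

lemma grad_spec (f : M → ℝ) (x : M) (v : T E x) : g x (grad g f x) v = dir f x v :=
  hg.sharp_spec (mvfderiv 𝓘(ℝ, E) f x : T E x →ₗ[ℝ] ℝ) v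

lemma koszul_add {X Y Z Z' : VField E M} {x : M} (hX : VDiffAt X x) (hY : VDiffAt Y x)
    (hZ : VDiffAt Z x) (hZ' : VDiffAt Z' x) :
    koszul g X Y (Z + Z') x = koszul g X Y Z x + koszul g X Y Z' x := by
  have h1 := dir_add (v := X x) (hg.smooth.mdiff_apply hY hZ) (hg.smooth.mdiff_apply hY hZ')
  have h2 := dir_add (v := Y x) (hg.smooth.mdiff_apply hX hZ) (hg.smooth.mdiff_apply hX hZ')
  simp only [koszul, Pi.add_apply, map_add, h1, h2, dir_vadd, lie_add_right hZ hZ', add_apply]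
  ring

/-- The derivatives of $f$ produced by the first two terms cancel against those from $[X,fZ]$ and
$[Y,fZ]$; the one along $Z$ is already linear. -/
lemma koszul_smul {X Y Z : VField E M} {f : M → ℝ} {x : M} (hX : VDiffAt X x) (hY : VDiffAt Y x)
    (hf : MDifferentiableAt 𝓘(ℝ, E) 𝓘(ℝ, ℝ) f x) (hZ : VDiffAt Z x) :
    koszul g X Y (f • Z) x = f x * koszul g X Y Z x := by
  have h1 := dir_mul (v := X x) hf (hg.smooth.mdiff_apply hY hZ)
  have h2 := dir_mul (v := Y x) hf (hg.smooth.mdiff_apply hX hZ)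
  simp only [koszul, Pi.smul_apply', map_smul, smul_eq_mul, h1, h2, dir_vsmul,
    lie_smul_right hf hZ, map_add, add_apply, smul_apply]
  rw [hg.symm x (Z x) (Y x), hg.symm x (Z x) (X x)]
  ring

lemma koszul_tensorial {X Y : VField E M} {x : M} (hX : VDiffAt X x) (hY : VDiffAt Y x) :
    TensorialAt 𝓘(ℝ, E) E (fun Z : VField E M ↦ koszul g X Y Z x) x where
  smul hf hσ := hg.koszul_smul hX hY hf hσ
  add hσ hσ' := hg.koszul_add hX hY hσ hσ'

/-- The definition of `nabla` tests only against the fields `extend E v`; tensoriality in $Z$ makes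
the Koszul formula valid for every $Z$ differentiable at the point. -/
lemma nabla_spec {X Y Z : VField E M} {x : M} (hX : VDiffAt X x) (hY : VDiffAt Y x)
    (hZ : VDiffAt Z x) : g x (nabla g X Y x) (Z x) = (1 / 2) * koszul g X Y Z x := by
  have ht := hg.koszul_tensorial hX hY
  let l : T E x →ₗ[ℝ] ℝ := ((1 / 2 : ℝ) • (TensorialAt.mkHom _ x ht : T E x →L[ℝ] ℝ) : _)
  have h1 := hg.sharp_spec l (Z x)
  have h2 : TensorialAt.mkHom _ x ht (Z x) = koszul g X Y Z x := TensorialAt.mkHom_apply ht hZ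
  calc g x (nabla g X Y x) (Z x) = l (Z x) := h1
    _ = (1 / 2) * TensorialAt.mkHom _ x ht (Z x) := rfl
    _ = _ := by rw [h2]

section algebra

variable {X Y Z : VField E M} {f : M → ℝ} {x : M}

lemma nabla_metric (hX : VDiffAt X x) (hY : VDiffAt Y x) (hZ : VDiffAt Z x) :
    dir (fun y ↦ g y (Y y) (Z y)) x (X x) = g x (nabla g X Y x) (Z x) + g x (Y x) (nabla g X Z x) := by
  rw [hg.symm x (Y x), hg.nabla_spec hX hY hZ, hg.nabla_spec hX hZ hY]
  have h1 : (fun y ↦ g y (Z y) (Y y)) = fun y ↦ g y (Y y) (Z y) := funext fun y ↦ hg.symm _ _ _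
  simp only [koszul, h1]
  rw [lie_swap Z Y]
  simp only [map_neg, neg_apply]
  ring

lemma nabla_torsion (hX : VDiffAt X x) (hY : VDiffAt Y x) :
    nabla g X Y x - nabla g Y X x = lie X Y x := by
  refine hg.ext_field fun Z hZ ↦ ?_
  rw [map_sub, sub_apply, hg.nabla_spec hX hY hZ, hg.nabla_spec hY hX hZ]
  have h1 : (fun y ↦ g y (Y y) (X y)) = fun y ↦ g y (X y) (Y y) := funext fun y ↦ hg.symm _ _ _
  simp only [koszul, h1]
  rw [lie_swap Y X]
  simp only [map_neg, neg_apply]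
  ring

lemma nabla_add_right (hX : VDiffAt X x) (hY : VDiffAt Y x) (hZ : VDiffAt Z x) :
    nabla g X (Y + Z) x = nabla g X Y x + nabla g X Z x := by
  refine hg.ext_field fun W hW ↦ ?_
  have h1 := hg.nabla_metric hX (hY.add hZ) hW
  have h2 := dir_add (v := X x) (hg.smooth.mdiff_apply hY hW) (hg.smooth.mdiff_apply hZ hW)
  simp only [Pi.add_apply, map_add, add_apply] at h1 ⊢
  rw [h2, hg.nabla_metric hX hY hW, hg.nabla_metric hX hZ hW] at h1
  linarith

lemma nabla_smul_right (hX : VDiffAt X x) (hf : MDifferentiableAt 𝓘(ℝ, E) 𝓘(ℝ, ℝ) f x)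
    (hY : VDiffAt Y x) :
    nabla g X (f • Y) x = dir f x (X x) • Y x + f x • nabla g X Y x := by
  refine hg.ext_field fun W hW ↦ ?_
  have h1 := hg.nabla_metric hX (VDiffAt.smul hf hY) hW
  have h2 := dir_mul (v := X x) hf (hg.smooth.mdiff_apply hY hW)
  simp only [Pi.smul_apply', map_smul, map_add, add_apply, smul_apply, smul_eq_mul] at h1 ⊢
  rw [h2, hg.nabla_metric hX hY hW] at h1
  linarith

/-- The rules in the first argument follow from those in the second by vanishing torsion and the
rules for the bracket. -/
lemma nabla_add_left (hX : VDiffAt X x) (hY : VDiffAt Y x) (hZ : VDiffAt Z x) :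
    nabla g (X + Y) Z x = nabla g X Z x + nabla g Y Z x := by
  have h1 := hg.nabla_torsion (hX.add hY) hZ
  have h2 := hg.nabla_torsion hX hZ
  have h3 := hg.nabla_torsion hY hZ
  rw [hg.nabla_add_right hZ hX hY, lie_add_left hX hY, ← h2, ← h3] at h1
  linear_combination (norm := module) h1

lemma nabla_smul_left (hf : MDifferentiableAt 𝓘(ℝ, E) 𝓘(ℝ, ℝ) f x) (hX : VDiffAt X x)
    (hY : VDiffAt Y x) : nabla g (f • X) Y x = f x • nabla g X Y x := by
  have h1 := hg.nabla_torsion (VDiffAt.smul hf hX) hY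
  have h2 := hg.nabla_torsion hX hY
  rw [hg.nabla_smul_right hY hf hX, lie_smul_left hf hX, ← h2] at h1
  linear_combination (norm := module) h1

lemma nabla_const_smul_right (c : ℝ) (hX : VDiffAt X x) (hY : VDiffAt Y x) :
    nabla g X (c • Y) x = c • nabla g X Y x := by
  have h := hg.nabla_smul_right (f := fun _ ↦ c) hX mdifferentiableAt_const hY
  rwa [dir_const, zero_smul, zero_add] at h

lemma nabla_neg_right (hX : VDiffAt X x) (hY : VDiffAt Y x) :
    nabla g X (-Y) x = -nabla g X Y x := by
  have h := hg.nabla_const_smul_right (-1) hX hY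
  rwa [neg_one_smul, neg_one_smul] at h

lemma nabla_sub_right (hX : VDiffAt X x) (hY : VDiffAt Y x) (hZ : VDiffAt Z x) :
    nabla g X (Y - Z) x = nabla g X Y x - nabla g X Z x := by
  have hZ' : VDiffAt (-Z) x := mdifferentiableAt_neg_section hZ
  rw [sub_eq_add_neg, hg.nabla_add_right hX hY hZ', hg.nabla_neg_right hX hZ, ← sub_eq_add_neg]

lemma nabla_neg_left (hX : VDiffAt X x) (hY : VDiffAt Y x) :
    nabla g (-X) Y x = -nabla g X Y x := by
  have h := hg.nabla_smul_left (f := fun _ ↦ (-1 : ℝ)) mdifferentiableAt_const hX hY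
  rw [neg_one_smul] at h
  rw [← h]
  congr 1
  ext1 y
  simp

/-- `∇_X Y` at `x` depends on `X` through its value at `x` only. -/
lemma nabla_left_eq {X' : VField E M} (hX : VDiffAt X x) (hX' : VDiffAt X' x) (hY : VDiffAt Y x)
    (h : X x = X' x) : nabla g X Y x = nabla g X' Y x := by
  have ht : TensorialAt 𝓘(ℝ, E) E (fun Z : VField E M ↦ nabla g Z Y x) x :=
    { smul := fun hf hσ ↦ hg.nabla_smul_left hf hσ hY
      add := fun hσ hσ' ↦ hg.nabla_add_left hσ hσ' hY }
  exact ht.pointwise hX hX' h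

end algebra

section smooth

variable [T2Space M]

/-- A vector field is smooth if its products with all smooth vector fields are. -/
lemma smoothV_of_apply {W : VField E M}
    (hW : ∀ Z : VField E M, SmoothV Z → SmoothF E (fun y ↦ g y (W y) (Z y))) : SmoothV W := by
  intro x
  obtain ⟨S, hS, hb⟩ := exists_smooth_frame (E := E) x
  let G : M → Matrix (Fin (Module.finrank ℝ E)) (Fin (Module.finrank ℝ E)) ℝ :=
    fun y ↦ Matrix.of fun i j ↦ g y (S j y) (S i y)
  let B : M → Fin (Module.finrank ℝ E) → ℝ := fun y i ↦ g y (W y) (S i y)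
  have hG : ∀ i j, SmoothF E (fun y ↦ G y i j) := fun i j ↦ hg.smooth.apply (hS j) (hS i)
  have hB : ∀ i, SmoothF E (fun y ↦ B y i) := fun i ↦ hW _ (hS i)
  -- A kernel vector of the Gram matrix would give a combination of the frame orthogonal to
  -- everything.
  have hdet : ∀ᶠ y in 𝓝 x, (G y).det ≠ 0 := by
    filter_upwards [hb] with y ⟨b, hb⟩ h0
    obtain ⟨c, hc, hc0⟩ := Matrix.exists_mulVec_eq_zero_iff.2 h0
    have : ∑ j, c j • b j = 0 := by
      refine hg.nondeg y _ fun w ↦ ?_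
      have h1 : ∀ i, g y (∑ j, c j • b j) (b i) = 0 := by
        intro i
        have := congrFun hc0 i
        simp only [Matrix.mulVec, dotProduct, G, Matrix.of_apply, Pi.zero_apply] at this
        simp only [map_sum, map_smul, sum_apply, smul_apply, smul_eq_mul, hb]
        rw [← this]
        exact Finset.sum_congr rfl fun j _ ↦ mul_comm _ _
      generalize ∑ j, c j • b j = u at h1
      rw [← b.sum_repr w]
      simp only [map_sum, map_smul, h1, smul_zero, Finset.sum_const_zero]
    exact hc (funext fun j ↦ Fintype.linearIndependent_iff.1 b.linearIndependent c this j)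
  -- Cramer's rule writes the coefficients of $W$ as quotients of determinants of smooth functions.
  have hex : ∀ᶠ y in 𝓝 x, W y = ∑ j, (((G y).updateCol j (B y)).det / (G y).det) • S j y := by
    filter_upwards [hb, hdet] with y ⟨b, hb⟩ hd
    have h1 : (G y).mulVec (b.repr (W y)) = B y := by
      ext i
      simp only [Matrix.mulVec, dotProduct, G, Matrix.of_apply, B]
      conv_rhs => rw [← b.sum_repr (W y)]
      simp only [map_sum, map_smul, sum_apply, smul_apply, smul_eq_mul, hb]
      exact Finset.sum_congr rfl fun j _ ↦ mul_comm _ _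
    have h2 : ∀ j, ((G y).updateCol j (B y)).det = (G y).det * b.repr (W y) j := by
      intro j
      rw [← Matrix.cramer_apply, ← h1, Matrix.cramer_eq_adjugate_mulVec, Matrix.mulVec_mulVec,
        Matrix.adjugate_mul, Matrix.smul_mulVec, Matrix.one_mulVec]
      simp
    conv_lhs => rw [← b.sum_repr (W y)]
    refine Finset.sum_congr rfl fun j _ ↦ ?_
    rw [h2 j, mul_div_cancel_left₀ _ hd, hb]
  have hsm : ContMDiffAt 𝓘(ℝ, E) (𝓘(ℝ, E).prod 𝓘(ℝ, E)) ∞ (fun y ↦ TotalSpace.mk' E y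
      (∑ j, (((G y).updateCol j (B y)).det / (G y).det) • S j y)) x := by
    refine ContMDiffAt.sum_section fun j _ ↦ ContMDiffAt.smul_section (ContMDiffAt.div₀
      (contMDiffAt_det fun i k ↦ ?_) (contMDiffAt_det fun i k ↦ (hG i k).contMDiffAt)
      hdet.self_of_nhds) (hS j).contMDiffAt
    by_cases hk : k = j
    · subst hk
      simpa using (hB i).contMDiffAt
    · simpa [Matrix.updateCol_apply, hk] using (hG i k).contMDiffAt
  exact hsm.congr_of_eventuallyEq (hex.mono fun y hy ↦ congrArg (TotalSpace.mk' E y) hy)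

lemma smoothV_grad {f : M → ℝ} (hf : SmoothF E f) : SmoothV (grad g f) := by
  refine hg.smoothV_of_apply fun Z hZ ↦ ?_
  simp only [hg.grad_spec]
  exact hf.der hZ

lemma smoothV_nabla {X Y : VField E M} (hX : SmoothV X) (hY : SmoothV Y) :
    SmoothV (nabla g X Y) := by
  refine hg.smoothV_of_apply fun Z hZ ↦ ?_
  have h1 : (fun y ↦ g y (nabla g X Y y) (Z y)) = fun y ↦ (1 / 2) * koszul g X Y Z y :=
    funext fun y ↦ hg.nabla_spec (hX.vdiff y) (hY.vdiff y) (hZ.vdiff y)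
  rw [h1]
  have hs := hg.smooth
  exact contMDiff_const.mul ((((((hs.apply hY hZ).der hX).add ((hs.apply hX hZ).der hY)).sub
    ((hs.apply hX hY).der hZ)).add (hs.apply (hX.lie hY) hZ)).sub
    (hs.apply (hX.lie hZ) hY) |>.sub (hs.apply (hY.lie hZ) hX))

end smooth

end IsSemiRiemannian

end ParaGeom

end

noncomputable section

namespace ParaGeom

open Filter Topology

variable {E : Type*} [NormedAddCommGroup E] [NormedSpace ℝ E]
  {M : Type*} [TopologicalSpace M] [ChartedSpace E M] [IsManifold 𝓘(ℝ, E) ∞ M]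

/-! ### The curvature tensor -/

lemma curvature_congr {g : BilinField E M} {X X' Y Y' Z Z' : VField E M} {x : M}
    (hX : ∀ᶠ y in 𝓝 x, X y = X' y) (hY : ∀ᶠ y in 𝓝 x, Y y = Y' y)
    (hZ : ∀ᶠ y in 𝓝 x, Z y = Z' y) : curvature g X Y Z x = curvature g X' Y' Z' x := by
  have hX2 := hX.eventually_nhds
  have hY2 := hY.eventually_nhds
  have hZ2 := hZ.eventually_nhds
  unfold curvature
  rw [nabla_congr hX ((hY2.and hZ2).mono fun y hy ↦ nabla_congr hy.1 hy.2),
    nabla_congr hY ((hX2.and hZ2).mono fun y hy ↦ nabla_congr hy.1 hy.2),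
    nabla_congr ((hX2.and hY2).mono fun y hy ↦ lie_congr hy.1 hy.2) hZ]

variable [FiniteDimensional ℝ E]

lemma IsSemiRiemannian.curvature_swap {g : BilinField E M} (hg : IsSemiRiemannian g)
    {X Y Z : VField E M} (hX : SmoothV X) (hY : SmoothV Y) (hZ : SmoothV Z) (x : M) : curvature g X Y Z x = -curvature g Y X Z x := by
  simp only [curvature]
  rw [lie_swap' X Y, hg.nabla_neg_left ((hY.lie hX).vdiff x) (hZ.vdiff x)]
  abel

variable [T2Space M]

namespace IsSemiRiemannian

variable {g : BilinField E M} (hg : IsSemiRiemannian g)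
  {X Y Z W : VField E M} {f : M → ℝ} (hX : SmoothV X) (hY : SmoothV Y) (hZ : SmoothV Z)

include hg hX hY hZ

lemma curvature_add_left (hW : SmoothV W) (x : M) :
    curvature g (X + W) Y Z x = curvature g X Y Z x + curvature g W Y Z x := by
  have h1 : nabla g (X + W) Z = nabla g X Z + nabla g W Z :=
    funext fun y ↦ hg.nabla_add_left (hX.vdiff y) (hW.vdiff y) (hZ.vdiff y)
  have h2 : lie (X + W) Y = lie X Y + lie W Y :=
    funext fun y ↦ lie_add_left (hX.vdiff y) (hW.vdiff y)
  simp only [curvature]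
  rw [h1, h2, hg.nabla_add_left (hX.vdiff x) (hW.vdiff x) ((hg.smoothV_nabla hY hZ).vdiff x),
    hg.nabla_add_left ((hX.lie hY).vdiff x) ((hW.lie hY).vdiff x) (hZ.vdiff x),
    hg.nabla_add_right (hY.vdiff x) ((hg.smoothV_nabla hX hZ).vdiff x)
      ((hg.smoothV_nabla hW hZ).vdiff x)]
  abel

lemma curvature_smul_left (hf : SmoothF E f) (x : M) :
    curvature g (f • X) Y Z x = f x • curvature g X Y Z x := by
  have h1 : nabla g (f • X) Z = f • nabla g X Z :=
    funext fun y ↦ hg.nabla_smul_left (hf.mdiff y) (hX.vdiff y) (hZ.vdiff y)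
  have h2 : lie (f • X) Y = (fun y ↦ -der Y f y) • X + f • lie X Y :=
    funext fun y ↦ lie_smul_left (hf.mdiff y) (hX.vdiff y)
  have hn : SmoothF E (fun y ↦ -der Y f y) := (hf.der hY).neg
  simp only [curvature]
  rw [h1, h2, hg.nabla_smul_left (hf.mdiff x) (hX.vdiff x) ((hg.smoothV_nabla hY hZ).vdiff x),
    hg.nabla_smul_right (hY.vdiff x) (hf.mdiff x) ((hg.smoothV_nabla hX hZ).vdiff x),
    hg.nabla_add_left ((SmoothV.smul hn hX).vdiff x) ((SmoothV.smul hf (hX.lie hY)).vdiff x)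
      (hZ.vdiff x),
    hg.nabla_smul_left (hn.mdiff x) (hX.vdiff x) (hZ.vdiff x),
    hg.nabla_smul_left (hf.mdiff x) ((hX.lie hY).vdiff x) (hZ.vdiff x)]
  module

lemma curvature_add_right (hW : SmoothV W) (x : M) :
    curvature g X Y (Z + W) x = curvature g X Y Z x + curvature g X Y W x := by
  have h1 : ∀ U : VField E M, SmoothV U → nabla g U (Z + W) = nabla g U Z + nabla g U W :=
    fun U hU ↦ funext fun y ↦ hg.nabla_add_right (hU.vdiff y) (hZ.vdiff y) (hW.vdiff y)
  simp only [curvature]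
  rw [h1 X hX, h1 Y hY, hg.nabla_add_right (hX.vdiff x) ((hg.smoothV_nabla hY hZ).vdiff x)
      ((hg.smoothV_nabla hY hW).vdiff x),
    hg.nabla_add_right (hY.vdiff x) ((hg.smoothV_nabla hX hZ).vdiff x)
      ((hg.smoothV_nabla hX hW).vdiff x),
    hg.nabla_add_right ((hX.lie hY).vdiff x) (hZ.vdiff x) (hW.vdiff x)]
  abel

/-- The first derivatives of $f$ cancel by symmetry in $X$, $Y$, and the second derivatives combine
to $X(Yf)-Y(Xf)-[X,Y]f=0$. -/
lemma curvature_smul_right (hf : SmoothF E f) (x : M) :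
    curvature g X Y (f • Z) x = f x • curvature g X Y Z x := by
  have h1 : ∀ U : VField E M, SmoothV U → nabla g U (f • Z) = der U f • Z + f • nabla g U Z :=
    fun U hU ↦ funext fun y ↦ hg.nabla_smul_right (hU.vdiff y) (hf.mdiff y) (hZ.vdiff y)
  have h2 : ∀ U V : VField E M, SmoothV U → SmoothV V → nabla g U (nabla g V (f • Z)) x =
      dir (der V f) x (U x) • Z x + dir f x (V x) • nabla g U Z x
        + dir f x (U x) • nabla g V Z x + f x • nabla g U (nabla g V Z) x := by
    intro U V hU hV
    rw [h1 V hV, hg.nabla_add_right (hU.vdiff x) ((SmoothV.smul (hf.der hV) hZ).vdiff x)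
      ((SmoothV.smul hf (hg.smoothV_nabla hV hZ)).vdiff x),
      hg.nabla_smul_right (hU.vdiff x) ((hf.der hV).mdiff x) (hZ.vdiff x),
      hg.nabla_smul_right (hU.vdiff x) (hf.mdiff x) ((hg.smoothV_nabla hV hZ).vdiff x)]
    abel
  simp only [curvature]
  rw [h2 X Y hX hY, h2 Y X hY hX,
    hg.nabla_smul_right ((hX.lie hY).vdiff x) (hf.mdiff x) (hZ.vdiff x), dir_lie hX hY hf]
  module

/-- The skew-symmetry of `R(X, Y)`. -/
lemma curvature_skew (hW : SmoothV W) (x : M) :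
    g x (curvature g X Y Z x) (W x) = -g x (Z x) (curvature g X Y W x) := by
  have hF := hg.smooth.apply hZ hW
  have h1 : ∀ U : VField E M, SmoothV U → der U (fun y ↦ g y (Z y) (W y)) =
      fun y ↦ g y (nabla g U Z y) (W y) + g y (Z y) (nabla g U W y) :=
    fun U hU ↦ funext fun y ↦ hg.nabla_metric (hU.vdiff y) (hZ.vdiff y) (hW.vdiff y)
  -- Differentiating $g(Z,W)$ twice: the two mixed terms are symmetric in $U$, $V$ and drop out of
  -- the commutator, which equals the derivative along $[X,Y]$.
  have h2 : ∀ U V : VField E M, SmoothV U → SmoothV V →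
      dir (der V (fun y ↦ g y (Z y) (W y))) x (U x) =
        g x (nabla g U (nabla g V Z) x) (W x) + g x (nabla g V Z x) (nabla g U W x)
        + g x (nabla g U Z x) (nabla g V W x) + g x (Z x) (nabla g U (nabla g V W) x) := by
    intro U V hU hV
    have hVZ := hg.smoothV_nabla hV hZ
    have hVW := hg.smoothV_nabla hV hW
    rw [h1 V hV, dir_add ((hg.smooth.apply hVZ hW).mdiff x) ((hg.smooth.apply hZ hVW).mdiff x),
      hg.nabla_metric (hU.vdiff x) (hVZ.vdiff x) (hW.vdiff x),
      hg.nabla_metric (hU.vdiff x) (hZ.vdiff x) (hVW.vdiff x)]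
    ring
  have h3 := dir_lie hX hY hF x
  rw [h2 X Y hX hY, h2 Y X hY hX,
    hg.nabla_metric ((hX.lie hY).vdiff x) (hZ.vdiff x) (hW.vdiff x)] at h3
  simp only [curvature, map_sub, sub_apply]
  linarith

/-- The first Bianchi identity. -/
lemma bianchi_first (x : M) :
    curvature g X Y Z x + curvature g Y Z X x + curvature g Z X Y x = 0 := by
  -- Vanishing torsion, used twice, turns the cyclic sum of curvatures into the Jacobi identity.
  have h1 : ∀ U V W : VField E M, SmoothV U → SmoothV V → SmoothV W →
      nabla g U (nabla g V W) x - nabla g U (nabla g W V) x - nabla g (lie V W) U x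
        = lie U (lie V W) x := by
    intro U V W hU hV hW
    rw [← hg.nabla_sub_right (hU.vdiff x) ((hg.smoothV_nabla hV hW).vdiff x)
      ((hg.smoothV_nabla hW hV).vdiff x)]
    have h2 : nabla g V W - nabla g W V = lie V W :=
      funext fun y ↦ hg.nabla_torsion (hV.vdiff y) (hW.vdiff y)
    rw [h2, hg.nabla_torsion (hU.vdiff x) ((hV.lie hW).vdiff x)]
  have h3 := lie_jacobi hX hY hZ x
  have h4 := h1 X Y Z hX hY hZ
  have h5 := h1 Y Z X hY hZ hX
  have h6 := h1 Z X Y hZ hX hY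
  have h7 : lie Y (lie X Z) x = -lie Y (lie Z X) x := by
    rw [lie_swap' X Z, lie_neg_right ((hZ.lie hX).vdiff x)]
  have h8 := lie_swap (lie X Y) Z x
  rw [h7, h8, ← h4, ← h5, ← h6] at h3
  simp only [curvature]
  linear_combination (norm := module) h3

/-- The second Bianchi identity. -/
lemma bianchi_second (hW : SmoothV W) (x : M) :
    (nabla g X (curvature g Y Z W) x - curvature g Y Z (nabla g X W) x
        + curvature g X (lie Y Z) W x)
      + (nabla g Y (curvature g Z X W) x - curvature g Z X (nabla g Y W) x
        + curvature g Y (lie Z X) W x)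
      + (nabla g Z (curvature g X Y W) x - curvature g X Y (nabla g Z W) x
        + curvature g Z (lie X Y) W x) = 0 := by
  -- The bracket terms of the statement are the usual $-R(\nabla_XY,Z)W-R(Y,\nabla_XZ)W$ of the
  -- covariant derivative of $R$, regrouped over the cyclic sum by vanishing torsion.
  have h1 : ∀ U V P : VField E M, SmoothV U → SmoothV V → SmoothV P →
      nabla g U (curvature g V P W) x = nabla g U (nabla g V (nabla g P W)) x
        - nabla g U (nabla g P (nabla g V W)) x - nabla g U (nabla g (lie V P) W) x := by
    intro U V P hU hV hP
    have h2 : curvature g V P W =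
        nabla g V (nabla g P W) - nabla g P (nabla g V W) - nabla g (lie V P) W := rfl
    have hVP := hg.smoothV_nabla hV (hg.smoothV_nabla hP hW)
    have hPV := hg.smoothV_nabla hP (hg.smoothV_nabla hV hW)
    rw [h2, hg.nabla_sub_right (hU.vdiff x) ((hVP.sub hPV).vdiff x)
      ((hg.smoothV_nabla (hV.lie hP) hW).vdiff x),
      hg.nabla_sub_right (hU.vdiff x) (hVP.vdiff x) (hPV.vdiff x)]
  have h3 : lie X (lie Y Z) = -lie Z (lie X Y) + -lie Y (lie Z X) := by
    ext1 y
    have h7 : lie Y (lie X Z) y = -lie Y (lie Z X) y := by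
      rw [lie_swap' X Z, lie_neg_right ((hZ.lie hX).vdiff y)]
    rw [lie_jacobi hX hY hZ y, h7, lie_swap (lie X Y) Z]
    rfl
  have hZXY := hZ.lie (hX.lie hY)
  have hYZX := hY.lie (hZ.lie hX)
  have h4 : nabla g (lie X (lie Y Z)) W x
      = -nabla g (lie Z (lie X Y)) W x - nabla g (lie Y (lie Z X)) W x := by
    rw [h3, hg.nabla_add_left (hZXY.neg.vdiff x) (hYZX.neg.vdiff x) (hW.vdiff x),
      hg.nabla_neg_left (hZXY.vdiff x) (hW.vdiff x), hg.nabla_neg_left (hYZX.vdiff x) (hW.vdiff x),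
      ← sub_eq_add_neg]
  rw [h1 X Y Z hX hY hZ, h1 Y Z X hY hZ hX, h1 Z X Y hZ hX hY]
  simp only [curvature]
  rw [h4]
  abel

/-- The curvature is a tensor. -/
lemma curvature_eq_curvatureAt (x : M) :
    curvature g X Y Z x = curvatureAt g x (X x) (Y x) (Z x) := by
  obtain ⟨U, hU, hUx⟩ := exists_smoothV_eventuallyEq_extend (X x)
  obtain ⟨V, hV, hVx⟩ := exists_smoothV_eventuallyEq_extend (Y x)
  obtain ⟨P, hP, hPx⟩ := exists_smoothV_eventuallyEq_extend (Z x)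
  have hUx' : U x = X x := hUx.self_of_nhds.trans (extend_apply_self E (X x))
  have hVx' : V x = Y x := hVx.self_of_nhds.trans (extend_apply_self E (Y x))
  have hPx' : P x = Z x := hPx.self_of_nhds.trans (extend_apply_self E (Z x))
  have e1 : curvatureAt g x (X x) (Y x) (Z x) = curvature g U V P x :=
    (curvature_congr hUx hVx hPx).symm
  have e2 : curvature g X Y Z x = curvature g U Y Z x :=
    eq_of_smooth_linear (Φ := fun S ↦ curvature g S Y Z x)
      (fun S S' hS hS' ↦ hg.curvature_add_left hS hY hZ hS' x)
      (fun f S hf hS ↦ hg.curvature_smul_left hS hY hZ hf x) hX hU hUx'.symm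
  -- The second slot is handled through the first, by skew-symmetry.
  have e3 : curvature g Y U Z x = curvature g V U Z x :=
    eq_of_smooth_linear (Φ := fun S ↦ curvature g S U Z x)
      (fun S S' hS hS' ↦ hg.curvature_add_left hS hU hZ hS' x)
      (fun f S hf hS ↦ hg.curvature_smul_left hS hU hZ hf x) hY hV hVx'.symm
  have e4 : curvature g U V Z x = curvature g U V P x :=
    eq_of_smooth_linear (Φ := fun S ↦ curvature g U V S x)
      (fun S S' hS hS' ↦ hg.curvature_add_right hU hV hS hS' x)
      (fun f S hf hS ↦ hg.curvature_smul_right hU hV hS hf x) hZ hP hPx'.symm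
  rw [e1, e2, hg.curvature_swap hU hY hZ, e3, ← hg.curvature_swap hU hV hZ, e4]

end IsSemiRiemannian

end ParaGeom

end

noncomputable section

namespace ParaGeom

open Filter Topology

variable {E : Type*} [NormedAddCommGroup E] [NormedSpace ℝ E]
  {M : Type*} [TopologicalSpace M] [ChartedSpace E M] [IsManifold 𝓘(ℝ, E) ∞ M]

/-! ### Algebraic symmetries of the curvature tensor on tangent vectors -/

section curvatureAt

variable [FiniteDimensional ℝ E]

namespace IsSemiRiemannian

variable [T2Space M] {g : BilinField E M} (hg : IsSemiRiemannian g) {x : M}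

include hg

lemma curvatureAt_swap (u v w : T E x) : curvatureAt g x u v w = -curvatureAt g x v u w := by
  obtain ⟨U, hU, rfl⟩ := exists_smoothV_apply_eq u
  obtain ⟨V, hV, rfl⟩ := exists_smoothV_apply_eq v
  obtain ⟨W, hW, rfl⟩ := exists_smoothV_apply_eq w
  rw [← hg.curvature_eq_curvatureAt hU hV hW, ← hg.curvature_eq_curvatureAt hV hU hW,
    hg.curvature_swap hU hV hW]

lemma curvatureAt_add_left (u u' v w : T E x) :
    curvatureAt g x (u + u') v w = curvatureAt g x u v w + curvatureAt g x u' v w := by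
  obtain ⟨U, hU, rfl⟩ := exists_smoothV_apply_eq u
  obtain ⟨U', hU', rfl⟩ := exists_smoothV_apply_eq u'
  obtain ⟨V, hV, rfl⟩ := exists_smoothV_apply_eq v
  obtain ⟨W, hW, rfl⟩ := exists_smoothV_apply_eq w
  rw [← hg.curvature_eq_curvatureAt hU hV hW, ← hg.curvature_eq_curvatureAt hU' hV hW,
    ← hg.curvature_add_left hU hV hW hU' x, hg.curvature_eq_curvatureAt (hU.add hU') hV hW]
  rfl

lemma curvatureAt_smul_left (c : ℝ) (u v w : T E x) :
    curvatureAt g x (c • u) v w = c • curvatureAt g x u v w := by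
  obtain ⟨U, hU, rfl⟩ := exists_smoothV_apply_eq u
  obtain ⟨V, hV, rfl⟩ := exists_smoothV_apply_eq v
  obtain ⟨W, hW, rfl⟩ := exists_smoothV_apply_eq w
  have hc : SmoothF E (fun _ : M ↦ c) := contMDiff_const
  rw [← hg.curvature_eq_curvatureAt hU hV hW, ← hg.curvature_smul_left hU hV hW hc x,
    hg.curvature_eq_curvatureAt (SmoothV.smul hc hU) hV hW]
  rfl

lemma curvatureAt_add_right (u v w w' : T E x) :
    curvatureAt g x u v (w + w') = curvatureAt g x u v w + curvatureAt g x u v w' := by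
  obtain ⟨U, hU, rfl⟩ := exists_smoothV_apply_eq u
  obtain ⟨V, hV, rfl⟩ := exists_smoothV_apply_eq v
  obtain ⟨W, hW, rfl⟩ := exists_smoothV_apply_eq w
  obtain ⟨W', hW', rfl⟩ := exists_smoothV_apply_eq w'
  rw [← hg.curvature_eq_curvatureAt hU hV hW, ← hg.curvature_eq_curvatureAt hU hV hW',
    ← hg.curvature_add_right hU hV hW hW' x, hg.curvature_eq_curvatureAt hU hV (hW.add hW')]
  rfl

lemma curvatureAt_smul_right (c : ℝ) (u v w : T E x) :
    curvatureAt g x u v (c • w) = c • curvatureAt g x u v w := by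
  obtain ⟨U, hU, rfl⟩ := exists_smoothV_apply_eq u
  obtain ⟨V, hV, rfl⟩ := exists_smoothV_apply_eq v
  obtain ⟨W, hW, rfl⟩ := exists_smoothV_apply_eq w
  have hc : SmoothF E (fun _ : M ↦ c) := contMDiff_const
  rw [← hg.curvature_eq_curvatureAt hU hV hW, ← hg.curvature_smul_right hU hV hW hc x,
    hg.curvature_eq_curvatureAt hU hV (SmoothV.smul hc hW)]
  rfl

lemma curvatureAt_skew (u v w z : T E x) :
    g x (curvatureAt g x u v w) z = -g x w (curvatureAt g x u v z) := by
  obtain ⟨U, hU, rfl⟩ := exists_smoothV_apply_eq u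
  obtain ⟨V, hV, rfl⟩ := exists_smoothV_apply_eq v
  obtain ⟨W, hW, rfl⟩ := exists_smoothV_apply_eq w
  obtain ⟨Z, hZ, rfl⟩ := exists_smoothV_apply_eq z
  rw [← hg.curvature_eq_curvatureAt hU hV hW, ← hg.curvature_eq_curvatureAt hU hV hZ,
    hg.curvature_skew hU hV hW hZ]

lemma curvatureAt_bianchi (u v w : T E x) :
    curvatureAt g x u v w + curvatureAt g x v w u + curvatureAt g x w u v = 0 := by
  obtain ⟨U, hU, rfl⟩ := exists_smoothV_apply_eq u
  obtain ⟨V, hV, rfl⟩ := exists_smoothV_apply_eq v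
  obtain ⟨W, hW, rfl⟩ := exists_smoothV_apply_eq w
  rw [← hg.curvature_eq_curvatureAt hU hV hW, ← hg.curvature_eq_curvatureAt hV hW hU,
    ← hg.curvature_eq_curvatureAt hW hU hV, hg.bianchi_first hU hV hW]

end IsSemiRiemannian

end curvatureAt

/-! ### Para-Kenmotsu structures -/

section tensors

variable {φ : EndField E M} {ζ : VField E M} {η : OneForm E M} {g : BilinField E M}

/-- From $\phi^2\zeta=0$ and the formula for $\phi^2(\phi\zeta)$, $\phi\zeta=a\zeta$ with
$a=\eta(\phi\zeta)$; then $a^2\zeta=\phi^2\zeta=0$. -/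
lemma IsAlmostParacontact.phi_zeta (h : IsAlmostParacontact φ ζ η) (x : M) :
    φ x (ζ x) = 0 := by
  have h1 : φ x (φ x (ζ x)) = 0 := by simp [h.phi_sq, h.eta_zeta]
  have h2 := h.phi_sq x (φ x (ζ x))
  rw [h1, map_zero] at h2
  have h3 : φ x (ζ x) = η x (φ x (ζ x)) • ζ x := sub_eq_zero.1 h2.symm
  have h4 : η x (φ x (ζ x)) = 0 := by
    have h5 : φ x (φ x (ζ x)) = (η x (φ x (ζ x)) * η x (φ x (ζ x))) • ζ x := by
      conv_lhs => rw [h3, map_smul, h3]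
      rw [map_smul, h.eta_zeta, smul_smul]
      simp
    rw [h1] at h5
    have h6 := congrArg (η x) h5
    rw [map_smul, h.eta_zeta, map_zero] at h6
    simpa using h6.symm
  rw [h3, h4, zero_smul]

lemma IsAlmostParacontact.eta_phi (h : IsAlmostParacontact φ ζ η) (x : M) (v : T E x) :
    η x (φ x v) = 0 := by
  have h1 := h.phi_sq x (φ x v)
  rw [h.phi_sq x v, map_sub, map_smul, h.phi_zeta, smul_zero, sub_zero] at h1
  have h2 : η x (φ x v) • ζ x = 0 := by
    rw [← sub_eq_self, ← h1]
  have h3 := congrArg (η x) h2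
  rw [map_smul, h.eta_zeta, map_zero] at h3
  simpa using h3

lemma IsAlmostParacontactMetric.g_zeta (h : IsAlmostParacontactMetric φ ζ η g) (x : M)
    (v : T E x) : g x (ζ x) v = η x v := by
  have h1 := h.compat x (ζ x) v
  rw [h.paracontact.phi_zeta, h.paracontact.eta_zeta, map_zero, zero_apply] at h1
  linarith

lemma IsAlmostParacontactMetric.g_zeta' (h : IsAlmostParacontactMetric φ ζ η g) (x : M)
    (v : T E x) : g x v (ζ x) = η x v := by
  rw [h.metric.symm, h.g_zeta]

lemma IsAlmostParacontactMetric.phi_skew (h : IsAlmostParacontactMetric φ ζ η g) (x : M)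
    (v w : T E x) : g x (φ x v) w = -g x v (φ x w) := by
  have h1 := h.compat x v (φ x w)
  rw [h.paracontact.phi_sq, map_sub, map_smul, h.g_zeta', h.paracontact.eta_phi,
    h.paracontact.eta_phi] at h1
  simpa using h1

end tensors

namespace IsParaKenmotsu

variable {φ : EndField E M} {ζ : VField E M} {η : OneForm E M} {g : BilinField E M}
  (hM : IsParaKenmotsu φ ζ η g) {X Y Z : VField E M}

include hM

lemma acm : IsAlmostParacontactMetric φ ζ η g := hM.almost.paracontactMetric

lemma ac : IsAlmostParacontact φ ζ η := hM.acm.paracontact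

lemma metric : IsSemiRiemannian g := hM.acm.metric

lemma smooth_zeta : SmoothV ζ := hM.ac.smooth_zeta

lemma smooth_eta (hX : SmoothV X) : SmoothF E (fun y ↦ η y (X y)) := hM.ac.smooth_eta.apply hX

lemma eta_lie_zeta (hX : SmoothV X) (x : M) :
    η x (lie ζ X x) = dir (fun y ↦ η y (X y)) x (ζ x) := by
  have h1 := hM.almost.closed_eta x ζ X (hM.smooth_zeta.vdiff x) (hX.vdiff x)
  have h2 : (fun y ↦ η y (ζ y)) = fun _ ↦ (1 : ℝ) := funext hM.ac.eta_zeta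
  rw [extDerivOne, h2, dir_const] at h1
  linarith

/-- This is $L_\zeta\phi=0$. As $\phi\zeta=0$, normality on $(\zeta,X)$ reads
$\phi(\phi[\zeta,X]-[\zeta,\phi X])=0$; the vector in parentheses lies in $\ker\eta$ because
$d\eta=0$, and $\phi$ is injective there. -/
lemma lie_zeta_phi (hX : SmoothV X) (x : M) :
    lie ζ (fun y ↦ φ y (X y)) x = φ x (lie ζ X x) := by
  have hφX : SmoothV (fun y ↦ φ y (X y)) := hM.ac.smooth_phi.apply hX
  have hζ := hM.smooth_zeta
  have h1 := hM.normal x ζ X (hζ.vdiff x) (hX.vdiff x)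
  have h0 : (fun y ↦ φ y (ζ y)) = (0 : VField E M) := funext hM.ac.phi_zeta
  have h0' : ∀ W : VField E M, lie (0 : VField E M) W = 0 := fun W ↦ mlieBracket_zero_left
  rw [hM.almost.closed_eta x ζ X (hζ.vdiff x) (hX.vdiff x), zero_smul, nijenhuis, h0, h0', h0'] at h1
  simp only [Pi.zero_apply, map_zero, add_zero, sub_zero] at h1
  rw [← map_sub] at h1
  have h2 := congrArg (φ x) h1
  rw [hM.ac.phi_sq, map_zero, map_sub, hM.ac.eta_phi, hM.eta_lie_zeta hφX] at h2
  have h3 : (fun y ↦ η y (φ y (X y))) = fun _ ↦ (0 : ℝ) := funext fun y ↦ hM.ac.eta_phi y _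
  rw [h3, dir_const, sub_zero, zero_smul, sub_zero] at h2
  exact (sub_eq_zero.1 h2).symm

/-- The Lie derivative of `g` along `ζ` on a pair `(Y, φ Z)`. -/
lemma lieDeriv_metric_phi (hY : SmoothV Y) (hZ : SmoothV Z) (x : M) :
    dir (fun y ↦ g y (Y y) (φ y (Z y))) x (ζ x) - g x (lie ζ Y x) (φ x (Z x))
      - g x (Y x) (lie ζ (fun y ↦ φ y (Z y)) x) = 2 * g x (Y x) (φ x (Z x)) := by
  have hζ := hM.smooth_zeta
  have h1 := hM.almost.deriv_fundForm x ζ Y Z (hζ.vdiff x) (hY.vdiff x) (hZ.vdiff x)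
  have h2 : ∀ (y : M) (v : T E y), fundForm φ g y v (ζ y) = 0 := fun y v ↦ by
    rw [fundForm, hM.ac.phi_zeta, map_zero]
  have h3 : ∀ (y : M) (v : T E y), fundForm φ g y (ζ y) v = 0 := fun y v ↦ by
    rw [fundForm, hM.acm.g_zeta, hM.ac.eta_phi]
  simp only [extDerivTwo, wedgeOneTwo, h2, h3, dir_const, hM.ac.eta_zeta] at h1
  rw [lie_swap Z ζ, fundForm, fundForm, fundForm] at h1
  have h4 : g x (-lie ζ Z x) (φ x (Y x)) = g x (Y x) (φ x (lie ζ Z x)) := by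
    rw [map_neg, neg_apply, ← hM.acm.phi_skew, hM.metric.symm]
  rw [h4] at h1
  rw [hM.lie_zeta_phi hZ]
  simp only [fundForm] at h1
  linarith

variable [FiniteDimensional ℝ E]

/-- The Lie derivative of `g` along `ζ` is `2 (g - η ⊗ η)`. -/
lemma lieDeriv_metric (hY : SmoothV Y) (hZ : SmoothV Z) (x : M) :
    dir (fun y ↦ g y (Y y) (Z y)) x (ζ x) - g x (lie ζ Y x) (Z x) - g x (Y x) (lie ζ Z x)
      = 2 * (g x (Y x) (Z x) - η x (Y x) * η x (Z x)) := by
  have hζ := hM.smooth_zeta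
  have hφZ : SmoothV (fun y ↦ φ y (Z y)) := hM.ac.smooth_phi.apply hZ
  have hφφZ : SmoothV (fun y ↦ φ y (φ y (Z y))) := hM.ac.smooth_phi.apply hφZ
  have h1 := hM.lieDeriv_metric_phi hY hφZ x
  have hηY := hM.smooth_eta hY
  have hηZ := hM.smooth_eta hZ
  have hηη : SmoothF E (fun y ↦ η y (Z y) * η y (Y y)) := hηZ.mul hηY
  -- The preceding lemma at $\phi Z$ treats $\phi^2Z$, the part of $Z$ in $\ker\eta$; the
  -- $\zeta$-part contributes only derivatives of $\eta(Y)$ and $\eta(Z)$, which cancel through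
  -- $\eta([\zeta,Y])=\zeta\,\eta(Y)$.
  have h2 : Z = (fun y ↦ φ y (φ y (Z y))) + (fun y ↦ η y (Z y)) • ζ := by
    ext1 y
    simp [hM.ac.phi_sq]
  have h3 : lie ζ Z x = lie ζ (fun y ↦ φ y (φ y (Z y))) x
      + dir (fun y ↦ η y (Z y)) x (ζ x) • ζ x := by
    conv_lhs => rw [h2]
    rw [lie_add_right (hφφZ.vdiff x) ((SmoothV.smul hηZ hζ).vdiff x),
      lie_smul_right (hηZ.mdiff x) (hζ.vdiff x)]
    have : lie ζ ζ x = 0 := congrFun mlieBracket_self x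
    rw [this, smul_zero, add_zero]
  have h4 : (fun y ↦ g y (Y y) (Z y))
      = fun y ↦ g y (Y y) (φ y (φ y (Z y))) + η y (Z y) * η y (Y y) := by
    ext1 y
    rw [hM.ac.phi_sq, map_sub, map_smul, hM.acm.g_zeta', smul_eq_mul]
    ring
  have h5 : g x (lie ζ Y x) (φ x (φ x (Z x)))
      = g x (lie ζ Y x) (Z x) - η x (Z x) * dir (fun y ↦ η y (Y y)) x (ζ x) := by
    rw [hM.ac.phi_sq, map_sub, map_smul, hM.acm.g_zeta', smul_eq_mul, hM.eta_lie_zeta hY]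
  have h6 : g x (Y x) (φ x (φ x (Z x))) = g x (Y x) (Z x) - η x (Z x) * η x (Y x) := by
    rw [hM.ac.phi_sq, map_sub, map_smul, hM.acm.g_zeta', smul_eq_mul]
  rw [h4, dir_add ((hM.metric.smooth.apply hY hφφZ).mdiff x) (hηη.mdiff x),
    dir_mul (hηZ.mdiff x) (hηY.mdiff x), h3, map_add, map_smul, hM.acm.g_zeta', smul_eq_mul]
  rw [h5, h6] at h1
  linarith

variable [T2Space M]

/-- The Koszul formula regroups as $2g(\nabla_X\zeta,Z)=(L_\zeta g)(X,Z)+d\eta(X,Z)$. -/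
lemma nabla_zeta (hX : SmoothV X) : nabla g X ζ = X - (fun y ↦ η y (X y)) • ζ := by
  ext1 x
  refine hM.metric.ext fun w ↦ ?_
  obtain ⟨Z, hZ, rfl⟩ := exists_smoothV_apply_eq w
  have hζ := hM.smooth_zeta
  have h1 := hM.lieDeriv_metric hX hZ x
  have h2 := hM.almost.closed_eta x X Z (hX.vdiff x) (hZ.vdiff x)
  rw [hM.metric.nabla_spec (hX.vdiff x) (hζ.vdiff x) (hZ.vdiff x)]
  simp only [koszul, hM.acm.g_zeta, hM.acm.g_zeta', Pi.sub_apply, Pi.smul_apply', map_sub,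
    map_smul, sub_apply, smul_apply, smul_eq_mul]
  rw [extDerivOne] at h2
  rw [lie_swap X ζ, map_neg, neg_apply, hM.metric.symm x (lie ζ Z x) (X x)]
  linarith

lemma dir_eta (hX : SmoothV X) (hY : SmoothV Y) (x : M) :
    dir (fun y ↦ η y (Y y)) x (X x) =
      η x (nabla g X Y x) + (g x (X x) (Y x) - η x (X x) * η x (Y x)) := by
  have h1 := hM.metric.nabla_metric (hX.vdiff x) (hY.vdiff x) (hM.smooth_zeta.vdiff x)
  rw [hM.nabla_zeta hX] at h1
  simp only [hM.acm.g_zeta', Pi.sub_apply, Pi.smul_apply', map_sub, map_smul, smul_eq_mul] at h1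
  rw [h1, hM.metric.symm x (Y x)]

lemma curvature_zeta (hX : SmoothV X) (hY : SmoothV Y) (x : M) :
    curvature g X Y ζ x = η x (X x) • Y x - η x (Y x) • X x := by
  have hζ := hM.smooth_zeta
  have h1 : ∀ U V : VField E M, SmoothV U → SmoothV V → nabla g U (nabla g V ζ) x =
      nabla g U V x - dir (fun y ↦ η y (V y)) x (U x) • ζ x
        - η x (V x) • (U x - η x (U x) • ζ x) := by
    intro U V hU hV
    have hηV := hM.smooth_eta hV
    rw [hM.nabla_zeta hV, hM.metric.nabla_sub_right (hU.vdiff x) (hV.vdiff x)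
      ((SmoothV.smul hηV hζ).vdiff x),
      hM.metric.nabla_smul_right (hU.vdiff x) (hηV.mdiff x) (hζ.vdiff x), hM.nabla_zeta hU]
    simp only [Pi.sub_apply, Pi.smul_apply']
    abel
  have h2 := hM.almost.closed_eta x X Y (hX.vdiff x) (hY.vdiff x)
  have h3 := hM.metric.nabla_torsion (hX.vdiff x) (hY.vdiff x)
  have h4 : dir (fun y ↦ η y (Y y)) x (X x)
      = dir (fun y ↦ η y (X y)) x (Y x) + η x (lie X Y x) := by
    rw [extDerivOne] at h2
    linarith
  simp only [curvature]
  rw [h1 X Y hX hY, h1 Y X hY hX, hM.nabla_zeta (hX.lie hY), h4]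
  simp only [Pi.sub_apply, Pi.smul_apply']
  rw [← h3]
  module

lemma curvatureAt_zeta {x : M} (u v : T E x) :
    curvatureAt g x u v (ζ x) = η x u • v - η x v • u := by
  obtain ⟨U, hU, rfl⟩ := exists_smoothV_apply_eq u
  obtain ⟨V, hV, rfl⟩ := exists_smoothV_apply_eq v
  rw [← hM.metric.curvature_eq_curvatureAt hU hV hM.smooth_zeta, hM.curvature_zeta hU hV]

end IsParaKenmotsu

end ParaGeom

end

noncomputable section

namespace ParaGeom

open Filter Topology

variable {E : Type*} [NormedAddCommGroup E] [NormedSpace ℝ E]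
  {M : Type*} [TopologicalSpace M] [ChartedSpace E M]

/-! ### The curvature of para-Kenmotsu manifolds of dimension three -/

lemma exists_not_smul_eq (hE : Module.finrank ℝ E = 3) {x : M} (v : T E x) :
    ∃ u : T E x, ∀ c : ℝ, c • v ≠ u := by
  by_contra! h
  have h1 : Module.finrank ℝ (T E x) = 3 := hE
  have := finrank_le_one v h
  omega

section trace

variable [FiniteDimensional ℝ E]

lemma traceAt_eq_trace (x : M) (A : T E x →ₗ[ℝ] T E x) :
    traceAt x A = LinearMap.trace ℝ (T E x) A := by
  let b : Module.Basis (Fin (Module.finrank ℝ E)) ℝ (T E x) := Module.finBasis ℝ E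
  rw [LinearMap.trace_eq_matrix_trace ℝ b A, Matrix.trace]
  simp only [Matrix.diag_apply, LinearMap.toMatrix_apply]
  rfl

end trace

variable [IsManifold 𝓘(ℝ, E) ∞ M]

/-- The curvature-like tensor
`-(g(v, w) u - g(u, w) v) + k (g'(v, w) u' - g'(u, w) v')`, where `u'` is the part of `u`
orthogonal to `ζ` and `g'(u, v) = g(u', v')`. -/
def modelCurvature (ζ : VField E M) (η : OneForm E M) (g : BilinField E M) (k : ℝ) (x : M)
    (u v w : T E x) : T E x :=
  -(g x v w • u - g x u w • v)
    + k • ((g x v w - η x v * η x w) • (u - η x u • ζ x)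
      - (g x u w - η x u * η x w) • (v - η x v • ζ x))

namespace IsParaKenmotsu

variable {φ : EndField E M} {ζ : VField E M} {η : OneForm E M} {g : BilinField E M}
  (hM : IsParaKenmotsu φ ζ η g)

include hM

lemma modelCurvature_skew (k : ℝ) {x : M} (u v w z : T E x) :
    g x (modelCurvature ζ η g k x u v w) z = -g x w (modelCurvature ζ η g k x u v z) := by
  simp only [modelCurvature, map_add, map_sub, map_neg, map_smul, add_apply, sub_apply,
    neg_apply, smul_apply, smul_eq_mul, hM.acm.g_zeta, hM.acm.g_zeta']
  rw [hM.metric.symm x w u, hM.metric.symm x w v]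
  ring

lemma modelCurvature_bianchi (k : ℝ) {x : M} (u v w : T E x) :
    modelCurvature ζ η g k x u v w + modelCurvature ζ η g k x v w u
      + modelCurvature ζ η g k x w u v = 0 := by
  simp only [modelCurvature]
  rw [hM.metric.symm x w u, hM.metric.symm x w v, hM.metric.symm x v u]
  module

lemma modelCurvature_zeta (k : ℝ) {x : M} (u v : T E x) :
    modelCurvature ζ η g k x u v (ζ x) = η x u • v - η x v • u := by
  simp only [modelCurvature, hM.acm.g_zeta', hM.ac.eta_zeta]
  module

/-- Otherwise polarization makes $g$ vanish on $\ker\eta$, which is also orthogonal to $\zeta$.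
Nondegeneracy then gives $\ker\eta=0$, so $\zeta$ would span the tangent space. -/
lemma exists_nonnull (hE : Module.finrank ℝ E = 3) (x : M) :
    ∃ v : T E x, η x v = 0 ∧ g x v v ≠ 0 := by
  by_contra! h
  have h1 : ∀ v w : T E x, η x v = 0 → η x w = 0 → g x v w = 0 := by
    intro v w hv hw
    have h2 := h (v + w) (by rw [map_add, hv, hw, add_zero])
    simp only [map_add, add_apply, h v hv, h w hw, hM.metric.symm x w v] at h2
    linarith
  have h2 : ∀ v : T E x, η x v = 0 → v = 0 := by
    intro v hv
    refine hM.metric.nondeg x v fun w ↦ ?_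
    have h3 := h1 v (w - η x w • ζ x) hv (by simp [hM.ac.eta_zeta])
    rwa [map_sub, map_smul, hM.acm.g_zeta', hv, smul_zero, sub_zero] at h3
  obtain ⟨u, hu⟩ := exists_not_smul_eq hE (ζ x)
  refine hu (η x u) (sub_eq_zero.1 (h2 _ ?_)).symm
  simp [hM.ac.eta_zeta]

/-- An orthogonal basis `ζ, v, φ v` of the tangent space. -/
lemma exists_orthogonal_basis (hE : Module.finrank ℝ E = 3) (x : M) :
    ∃ (b : Module.Basis (Fin 3) ℝ (T E x)) (c : ℝ), c ≠ 0 ∧ b 0 = ζ x ∧ η x (b 1) = 0 ∧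
      η x (b 2) = 0 ∧ g x (b 1) (b 1) = c ∧ g x (b 2) (b 2) = -c ∧ g x (b 1) (b 2) = 0 := by
  obtain ⟨v, hv, hc⟩ := hM.exists_nonnull hE x
  have hφ : g x v (φ x v) = 0 := by
    have h1 := hM.acm.phi_skew x v v
    rw [hM.metric.symm] at h1
    linarith
  have hφφ : g x (φ x v) (φ x v) = -g x v v := by
    rw [hM.acm.compat, hv]
    ring
  have hli : LinearIndependent ℝ ![ζ x, v, φ x v] := by
    rw [Fintype.linearIndependent_iff]
    intro a ha
    simp only [Fin.sum_univ_three, Matrix.cons_val] at ha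
    have h0 := congrArg (fun u ↦ g x u (ζ x)) ha
    have h1 := congrArg (fun u ↦ g x u v) ha
    have h2 := congrArg (fun u ↦ g x u (φ x v)) ha
    simp only [map_add, map_smul, add_apply, smul_apply, smul_eq_mul, map_zero, zero_apply,
      hM.acm.g_zeta', hM.ac.eta_zeta, hv, hM.ac.eta_phi, hM.acm.g_zeta, hφ, hφφ,
      hM.metric.symm x (φ x v) v] at h0 h1 h2
    have h1' : a 1 * g x v v = 0 := by linarith
    have h2' : a 2 * g x v v = 0 := by linarith
    intro i
    fin_cases i
    · simpa using h0
    · exact (mul_eq_zero.1 h1').resolve_right hc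
    · exact (mul_eq_zero.1 h2').resolve_right hc
  have hcard : Fintype.card (Fin 3) = Module.finrank ℝ (T E x) := by
    rw [Fintype.card_fin]
    exact hE.symm
  have hb := coe_basisOfLinearIndependentOfCardEqFinrank hli hcard
  refine ⟨basisOfLinearIndependentOfCardEqFinrank hli hcard, g x v v, hc, ?_⟩
  rw [hb]
  exact ⟨rfl, hv, hM.ac.eta_phi x v, rfl, hφφ, hφ⟩

variable [FiniteDimensional ℝ E]

/-- For fixed $v$, $w$ the operator $u\mapsto R(u,v)w$ is a multiple of the identity plus operators
of rank at most one, whose traces are explicit. -/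
lemma ricci_eq (hE : Module.finrank ℝ E = 3) {x : M} {k : ℝ}
    (hk : ∀ u v w : T E x, curvatureAt g x u v w = modelCurvature ζ η g k x u v w)
    (v w : T E x) :
    ricci g x v w = -2 * g x v w + k * (g x v w - η x v * η x w) := by
  let l : T E x →ₗ[ℝ] ℝ := (g x w : T E x →L[ℝ] ℝ)
  let e : T E x →ₗ[ℝ] ℝ := (η x : T E x →L[ℝ] ℝ)
  let A : T E x →ₗ[ℝ] T E x :=
    (-(g x v w) + k * (g x v w - η x v * η x w)) • LinearMap.id + l.smulRight v
      - e.smulRight ((k * (g x v w - η x v * η x w)) • ζ x)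
      - (l - η x w • e).smulRight (k • (v - η x v • ζ x))
  have hA : (fun u ↦ curvatureAt g x u v w) = A := by
    ext1 u
    rw [hk]
    simp only [modelCurvature, A, LinearMap.add_apply, LinearMap.sub_apply, LinearMap.smul_apply,
      LinearMap.smulRight_apply, LinearMap.id_apply, l, e, ContinuousLinearMap.coe_coe,
      hM.metric.symm x u w, smul_eq_mul]
    module
  have h3 : Module.finrank ℝ (T E x) = 3 := hE
  rw [ricci, hA, traceAt_eq_trace]
  simp only [A, map_add, map_sub, map_smul, LinearMap.trace_smulRight, LinearMap.trace_id, h3,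
    LinearMap.sub_apply, LinearMap.smul_apply, smul_eq_mul, l, e, ContinuousLinearMap.coe_coe,
    hM.ac.eta_zeta, hM.acm.g_zeta', hM.metric.symm x w v]
  push_cast
  ring

lemma scal_eq (hE : Module.finrank ℝ E = 3) {x : M} {k : ℝ}
    (hk : ∀ u v w : T E x, curvatureAt g x u v w = modelCurvature ζ η g k x u v w) :
    scal g x = -6 + 2 * k := by
  let e : T E x →ₗ[ℝ] ℝ := (η x : T E x →L[ℝ] ℝ)
  let A : T E x →ₗ[ℝ] T E x := (-2 + k) • LinearMap.id - e.smulRight (k • ζ x)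
  have hA : ricciOp g x = A := by
    ext1 v
    let l : T E x →ₗ[ℝ] ℝ := (g x (A v) : T E x →L[ℝ] ℝ)
    have hl : ricci g x v = l := by
      ext1 w
      rw [hM.ricci_eq hE hk]
      simp only [l, A, e, LinearMap.sub_apply, LinearMap.smul_apply, LinearMap.smulRight_apply,
        LinearMap.id_apply, ContinuousLinearMap.coe_coe, map_sub, map_smul, sub_apply, smul_apply,
        smul_eq_mul, hM.acm.g_zeta]
      ring
    rw [ricciOp, hl]
    exact hM.metric.ext fun w ↦ hM.metric.sharp_spec l w
  have h3 : Module.finrank ℝ (T E x) = 3 := hE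
  rw [scal, hA, traceAt_eq_trace]
  simp only [A, map_sub, map_smul, LinearMap.trace_smulRight, LinearMap.trace_id, h3,
    smul_eq_mul, e, ContinuousLinearMap.coe_coe, hM.ac.eta_zeta]
  push_cast
  ring

variable [T2Space M]

/-- In dimension three the curvature is determined by one function. -/
lemma exists_curvatureAt_eq (hE : Module.finrank ℝ E = 3) (x : M) :
    ∃ k : ℝ, ∀ u v w : T E x, curvatureAt g x u v w = modelCurvature ζ η g k x u v w := by
  obtain ⟨b, c, hc, hb0, he1, he2, h11, h22, h12⟩ := hM.exists_orthogonal_basis hE x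
  have hg := hM.metric
  -- The model gives $(k-1)c^2$ for this component, so $k$ is chosen to match it. The difference `F`
  -- then has all curvature symmetries, kills $\zeta$, and has to be shown zero.
  let k : ℝ := (g x (curvatureAt g x (b 1) (b 2) (b 1)) (b 2) + c ^ 2) / c ^ 2
  let F : T E x → T E x → T E x → T E x :=
    fun u v w ↦ curvatureAt g x u v w - modelCurvature ζ η g k x u v w
  have Fswap : ∀ u v w, F u v w = -F v u w := by
    intro u v w
    simp only [F, modelCurvature]
    rw [hg.curvatureAt_swap]
    module
  have Fadd : ∀ u u' v w, F (u + u') v w = F u v w + F u' v w := by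
    intro u u' v w
    simp only [F, modelCurvature, hg.curvatureAt_add_left, map_add, add_apply]
    module
  have Fsmul : ∀ (a : ℝ) u v w, F (a • u) v w = a • F u v w := by
    intro a u v w
    simp only [F, modelCurvature, hg.curvatureAt_smul_left, map_smul, smul_apply, smul_eq_mul]
    module
  have Fadd' : ∀ u v w w', F u v (w + w') = F u v w + F u v w' := by
    intro u v w w'
    simp only [F, modelCurvature, hg.curvatureAt_add_right, map_add]
    module
  have Fsmul' : ∀ (a : ℝ) u v w, F u v (a • w) = a • F u v w := by
    intro a u v w
    simp only [F, modelCurvature, hg.curvatureAt_smul_right, map_smul, smul_eq_mul]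
    module
  have Fskew : ∀ u v w z, g x (F u v w) z = -g x w (F u v z) := by
    intro u v w z
    simp only [F, map_sub, sub_apply, hg.curvatureAt_skew u v w z, hM.modelCurvature_skew k u v w z]
    ring
  have Fbianchi : ∀ u v w, F u v w + F v w u + F w u v = 0 := by
    intro u v w
    have h1 := hg.curvatureAt_bianchi u v w
    have h2 := hM.modelCurvature_bianchi k u v w
    simp only [F]
    linear_combination (norm := module) h1 - h2
  have Fzeta : ∀ u v, F u v (ζ x) = 0 := by
    intro u v
    simp only [F, hM.curvatureAt_zeta, hM.modelCurvature_zeta, sub_self]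
  have Fsymm : ∀ v w, F (ζ x) v w = F (ζ x) w v := by
    intro v w
    have h1 := Fbianchi (ζ x) v w
    rw [Fzeta, Fswap w (ζ x) v, add_zero, ← sub_eq_add_neg, sub_eq_zero] at h1
    exact h1
  -- The trilinear form $g(F(\zeta,v)w,z)$ is symmetric in $v,w$ and skew in $w,z$, hence zero.
  have Fzeta' : ∀ v w, F (ζ x) v w = 0 := by
    intro v w
    refine hg.nondeg x _ fun z ↦ ?_
    have e1 : ∀ v w z, g x (F (ζ x) v w) z = -g x (F (ζ x) v z) w := fun v w z ↦ by
      rw [Fskew, hg.symm]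
    have e2 : ∀ v w z, g x (F (ζ x) v w) z = g x (F (ζ x) w v) z := fun v w z ↦ by
      rw [Fsymm]
    linarith [e2 v w z, e1 w v z, e2 w z v, e1 z w v, e2 z v w, e1 v z w]
  have Fdiag : ∀ u w, F u u w = 0 := by
    intro u w
    refine hg.nondeg x _ fun z ↦ ?_
    have h1 := congrArg (fun a ↦ g x a z) (Fswap u u w)
    simp only [map_neg, neg_apply] at h1
    linarith
  have key : g x (F (b 1) (b 2) (b 1)) (b 2) = 0 := by
    simp only [F, modelCurvature, map_add, map_sub, map_neg, map_smul, add_apply, sub_apply,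
      neg_apply, smul_apply, smul_eq_mul, he1, he2, h11, h22, h12, hg.symm x (b 2) (b 1),
      hM.acm.g_zeta, k]
    field_simp
    ring
  have hself : ∀ u v w, g x (F u v w) w = 0 := by
    intro u v w
    have := Fskew u v w w
    rw [hg.symm x w] at this
    linarith
  have hperp : ∀ u : T E x, (∀ i, g x u (b i) = 0) → u = 0 := by
    intro u hu
    refine hg.nondeg x u fun w ↦ ?_
    rw [← b.sum_repr w]
    simp only [map_sum, map_smul, hu, smul_zero, Finset.sum_const_zero]
  have hz : ∀ u v w, g x (F u v w) (b 0) = 0 := by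
    intro u v w
    rw [Fskew, hb0, Fzeta, map_zero, neg_zero]
  -- The products with the three basis vectors vanish because `F` kills $\zeta$, by skewness, and by
  -- the choice of $k$.
  have F121 : F (b 1) (b 2) (b 1) = 0 := hperp _ (Fin.forall_fin_succ.2 ⟨hz _ _ _,
    Fin.forall_fin_succ.2 ⟨hself _ _ _, Fin.forall_fin_succ.2 ⟨key, Fin.forall_fin_zero.2 trivial⟩⟩⟩)
  have F122 : F (b 1) (b 2) (b 2) = 0 := by
    refine hperp _ (Fin.forall_fin_succ.2 ⟨hz _ _ _, Fin.forall_fin_succ.2 ⟨?_,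
      Fin.forall_fin_succ.2 ⟨hself _ _ _, Fin.forall_fin_zero.2 trivial⟩⟩⟩)
    have := Fskew (b 1) (b 2) (b 2) (b 1)
    rw [F121, map_zero, neg_zero] at this
    exact this
  have hdec : ∀ u : T E x,
      u = b.repr u 0 • ζ x + b.repr u 1 • b 1 + b.repr u 2 • b 2 := by
    intro u
    conv_lhs => rw [← b.sum_repr u, Fin.sum_univ_three, hb0]
  have F12 : ∀ w, F (b 1) (b 2) w = 0 := by
    intro w
    rw [hdec w, Fadd', Fadd', Fsmul', Fsmul', Fsmul', Fzeta, F121, F122]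
    simp
  have F1 : ∀ v w, F (b 1) v w = 0 := by
    intro v w
    rw [Fswap, hdec v, Fadd, Fadd, Fsmul, Fsmul, Fsmul, Fzeta', Fdiag, Fswap (b 2), F12]
    simp
  have F2 : ∀ v w, F (b 2) v w = 0 := by
    intro v w
    rw [Fswap, hdec v, Fadd, Fadd, Fsmul, Fsmul, Fsmul, Fzeta', Fdiag, F12]
    simp
  refine ⟨k, fun u v w ↦ sub_eq_zero.1 (?_ : F u v w = 0)⟩
  rw [hdec u, Fadd, Fadd, Fsmul, Fsmul, Fsmul, Fzeta', F1, F2]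
  simp

end IsParaKenmotsu

end ParaGeom

end

/-! ### Constant scalar curvature and the Hessian equation -/

noncomputable section

namespace ParaGeom

open Filter Topology

variable {E : Type*} [NormedAddCommGroup E] [NormedSpace ℝ E] [FiniteDimensional ℝ E]
  {M : Type*} [TopologicalSpace M] [ChartedSpace E M] [IsManifold 𝓘(ℝ, E) ∞ M] [T2Space M]

namespace IsParaKenmotsu

variable {φ : EndField E M} {ζ : VField E M} {η : OneForm E M} {g : BilinField E M}
  (hM : IsParaKenmotsu φ ζ η g)

include hM

/-- The second Bianchi identity for a curvature tensor of the form `modelCurvature` with a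
constant `k`, on fields orthogonal to `ζ`. -/
lemma bianchi_modelCurvature {k : ℝ}
    (hk : ∀ (y : M) (u v w : T E y), curvatureAt g y u v w = modelCurvature ζ η g k y u v w)
    {X Y W : VField E M} (hX : SmoothV X) (hY : SmoothV Y) (hW : SmoothV W)
    (eX : ∀ y, η y (X y) = 0) (eY : ∀ y, η y (Y y) = 0) (eW : ∀ y, η y (W y) = 0) (x : M) :
    k • (g x (Y x) (W x) • X x - g x (X x) (W x) • Y x) = 0 := by
  have hg := hM.metric
  have hζ := hM.smooth_zeta
  have hR : ∀ U V P : VField E M, SmoothV U → SmoothV V → SmoothV P → ∀ y,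
      curvature g U V P y = modelCurvature ζ η g k y (U y) (V y) (P y) :=
    fun U V P hU hV hP y ↦ by rw [hg.curvature_eq_curvatureAt hU hV hP, hk]
  have sYW : SmoothF E (fun y ↦ g y (Y y) (W y)) := hg.smooth.apply hY hW
  have sXW : SmoothF E (fun y ↦ g y (X y) (W y)) := hg.smooth.apply hX hW
  -- Orthogonality to $\zeta$ is assumed at every point so that it can be differentiated.
  have eη : ∀ (V : VField E M), (∀ y, η y (V y) = 0) → SmoothV V → ∀ U : VField E M, SmoothV U →
      η x (nabla g U V x) = -g x (U x) (V x) := by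
    intro V eV hV U hU
    have h1 := hM.dir_eta hU hV x
    have h2 : (fun y ↦ η y (V y)) = fun _ ↦ (0 : ℝ) := funext eV
    rw [h2, dir_const, eV, mul_zero, sub_zero] at h1
    linarith
  have zX : nabla g X ζ x = X x := by
    rw [hM.nabla_zeta hX]; simp [eX]
  have zY : nabla g Y ζ x = Y x := by
    rw [hM.nabla_zeta hY]; simp [eY]
  have r1 : curvature g X Y W = (k - 1) • ((fun y ↦ g y (Y y) (W y)) • X
      - (fun y ↦ g y (X y) (W y)) • Y) := by
    ext1 y
    rw [hR X Y W hX hY hW]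
    simp only [modelCurvature, eX, eY, eW, Pi.smul_apply, Pi.sub_apply, Pi.smul_apply']
    module
  have r2 : curvature g Y ζ W = (fun y ↦ g y (Y y) (W y)) • ζ := by
    ext1 y
    rw [hR Y ζ W hY hζ hW]
    simp only [modelCurvature, eY, eW, hM.ac.eta_zeta, hM.acm.g_zeta, Pi.smul_apply']
    module
  have r3 : curvature g ζ X W = -((fun y ↦ g y (X y) (W y)) • ζ) := by
    ext1 y
    rw [hR ζ X W hζ hX hW]
    simp only [modelCurvature, eX, eW, hM.ac.eta_zeta, hM.acm.g_zeta, Pi.smul_apply',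
      Pi.neg_apply]
    module
  have B := hg.bianchi_second hζ hX hY hW x
  have sA := SmoothV.smul sYW hX
  have sB := SmoothV.smul sXW hY
  have metr : ∀ U V : VField E M, SmoothV U → SmoothV V →
      dir (fun y ↦ g y (V y) (W y)) x (U x)
        = g x (nabla g U V x) (W x) + g x (V x) (nabla g U W x) :=
    fun U V hU hV ↦ hg.nabla_metric (hU.vdiff x) (hV.vdiff x) (hW.vdiff x)
  have tζX : lie ζ X x = nabla g ζ X x - X x := by
    rw [← hg.nabla_torsion (hζ.vdiff x) (hX.vdiff x), zX]
  have tYζ : lie Y ζ x = Y x - nabla g ζ Y x := by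
    rw [← hg.nabla_torsion (hY.vdiff x) (hζ.vdiff x), zY]
  have tXY := hg.nabla_torsion (hX.vdiff x) (hY.vdiff x)
  rw [r1, r2, r3, hR X Y _ hX hY (hg.smoothV_nabla hζ hW),
    hR Y ζ _ hY hζ (hg.smoothV_nabla hX hW), hR ζ X _ hζ hX (hg.smoothV_nabla hY hW),
    hR ζ _ _ hζ (hX.lie hY) hW, hR X _ _ hX (hY.lie hζ) hW, hR Y _ _ hY (hζ.lie hX) hW,
    hg.nabla_const_smul_right _ (hζ.vdiff x) ((sA.sub sB).vdiff x),
    hg.nabla_sub_right (hζ.vdiff x) (sA.vdiff x) (sB.vdiff x),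
    hg.nabla_smul_right (hζ.vdiff x) (sYW.mdiff x) (hX.vdiff x),
    hg.nabla_smul_right (hζ.vdiff x) (sXW.mdiff x) (hY.vdiff x),
    hg.nabla_smul_right (hX.vdiff x) (sYW.mdiff x) (hζ.vdiff x),
    hg.nabla_neg_right (hY.vdiff x) ((SmoothV.smul sXW hζ).vdiff x),
    hg.nabla_smul_right (hY.vdiff x) (sXW.mdiff x) (hζ.vdiff x),
    metr ζ Y hζ hY, metr ζ X hζ hX, metr X Y hX hY, metr Y X hY hX, zX, zY, tζX, tYζ, ← tXY] at B
  simp only [modelCurvature, map_sub, sub_apply, eX, eY, eW, hM.ac.eta_zeta, hM.acm.g_zeta,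
    eη X eX hX _ hζ, eη Y eY hY _ hζ, eη W eW hW _ hζ, eη W eW hW _ hX,
    eη W eW hW _ hY, eη X eX hX _ hY, eη Y eY hY _ hX] at B
  rw [hg.symm x (Y x) (X x)] at B
  -- With $k$ constant, the derivatives of $X$, $Y$, $W$ cancel. What remains comes from
  -- $\nabla_X\zeta=X$ and $\nabla_Y\zeta=Y$ and is proportional to $k$.
  have h2 : (2 : ℝ) • (k • (g x (Y x) (W x) • X x - g x (X x) (W x) • Y x)) = 0 := by
    linear_combination (norm := module) B
  exact (smul_eq_zero.1 h2).resolve_left two_ne_zero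

/-- A three-dimensional para-Kenmotsu manifold of constant scalar curvature has constant
curvature `-1`. -/
lemma curvatureAt_of_scal_const (hE : Module.finrank ℝ E = 3) {r : ℝ}
    (hr : ∀ x : M, scal g x = r) (x : M) (u v w : T E x) :
    curvatureAt g x u v w = modelCurvature ζ η g 0 x u v w := by
  have hk : ∀ (y : M) (u v w : T E y),
      curvatureAt g y u v w = modelCurvature ζ η g ((r + 6) / 2) y u v w := by
    intro y u v w
    obtain ⟨k, hk⟩ := hM.exists_curvatureAt_eq hE y
    have h1 := hM.scal_eq hE hk
    rw [hr] at h1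
    rw [hk, show k = (r + 6) / 2 by linarith]
  suffices h0 : (r + 6) / 2 = 0 by rw [hk, h0]
  obtain ⟨b, c, hc, hb0, he1, he2, h11, h22, h12⟩ := hM.exists_orthogonal_basis hE x
  obtain ⟨U, hU, hUx⟩ := exists_smoothV_apply_eq (b 1)
  obtain ⟨V, hV, hVx⟩ := exists_smoothV_apply_eq (b 2)
  -- Applying $\phi^2$ projects onto $\ker\eta$ everywhere without changing `b 1` and `b 2` at `x`.
  -- Taking $W=X$, the Bianchi vector at `x` is $-c$ times `b 2`, which is nonzero.
  have hφ : ∀ W : VField E M, SmoothV W → SmoothV (fun y ↦ φ y (φ y (W y))) :=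
    fun W hW ↦ hM.ac.smooth_phi.apply (hM.ac.smooth_phi.apply hW)
  have h1 := hM.bianchi_modelCurvature hk (hφ U hU) (hφ V hV) (hφ U hU)
    (fun y ↦ hM.ac.eta_phi y _) (fun y ↦ hM.ac.eta_phi y _) (fun y ↦ hM.ac.eta_phi y _) x
  simp only [hM.ac.phi_sq, hUx, hVx, he1, he2, zero_smul, sub_zero, h11,
    hM.metric.symm x (b 2) (b 1), h12, zero_sub] at h1
  have h2 := (smul_eq_zero.1 h1).resolve_right
    (neg_ne_zero.2 (smul_ne_zero hc (b.ne_zero 2)))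
  exact h2

end IsParaKenmotsu

/-- On a manifold of constant curvature `-1`, an equation `c ∇²f = -μ g` forces `c df = -dμ`. -/
lemma IsSemiRiemannian.grad_of_hess_eq {g : BilinField E M} (hg : IsSemiRiemannian g)
    (hE : Module.finrank ℝ E = 3)
    (hR : ∀ (x : M) (u v w : T E x), curvatureAt g x u v w = -(g x v w • u - g x u w • v))
    {f μ : M → ℝ} {c : ℝ} (hf : SmoothF E f) (hμ : SmoothF E μ)
    (hess_eq : ∀ (x : M) (v w : T E x), c * hess g f x v w = -μ x * g x v w) (x : M) (v : T E x) :
    c * dir f x v = -dir μ x v := by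
  have hD := hg.smoothV_grad hf
  have h1 : ∀ X : VField E M, SmoothV X → c • nabla g X (grad g f) = (fun y ↦ -μ y) • X := by
    intro X hX
    ext1 y
    refine hg.ext fun w ↦ ?_
    have h2 := hess_eq y (X y) w
    rw [hess, hg.nabla_left_eq (vdiff_extend (X y)) (hX.vdiff y) (hD.vdiff y)
      (extend_apply_self E (X y))] at h2
    simpa using h2
  have hμ' : SmoothF E (fun y ↦ -μ y) := hμ.neg
  -- Second covariant derivatives of the gradient, for evaluating $c\,R(X,Y)Df$; the terms in $\mu$
  -- itself cancel by vanishing torsion and only $d\mu$ survives.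
  have h2 : ∀ X Y : VField E M, SmoothV X → SmoothV Y →
      c • nabla g X (nabla g Y (grad g f)) x = -dir μ x (X x) • Y x + -μ x • nabla g X Y x := by
    intro X Y hX hY
    rw [← hg.nabla_const_smul_right c (hX.vdiff x) ((hg.smoothV_nabla hY hD).vdiff x), h1 Y hY,
      hg.nabla_smul_right (hX.vdiff x) (hμ'.mdiff x) (hY.vdiff x), dir_neg]
  by_contra hne
  obtain ⟨u, hu⟩ := exists_not_smul_eq hE v
  obtain ⟨X, hX, rfl⟩ := exists_smoothV_apply_eq u
  obtain ⟨Y, hY, rfl⟩ := exists_smoothV_apply_eq v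
  have h3 := hg.curvature_eq_curvatureAt hX hY hD x
  rw [hR, hg.symm x (Y x), hg.symm x (X x), hg.grad_spec, hg.grad_spec] at h3
  have h4 := congrArg (fun a ↦ c • a) h3
  have h5 := congrFun (h1 (lie X Y) (hX.lie hY)) x
  simp only [Pi.smul_apply, Pi.smul_apply'] at h5
  simp only [curvature, smul_sub, h2 X Y hX hY, h2 Y X hY hX, h5] at h4
  rw [← hg.nabla_torsion (hX.vdiff x) (hY.vdiff x)] at h4
  -- A nonzero coefficient would make $X_x$ a multiple of $Y_x$, against the choice of `u`.
  have hs : c * dir f x (Y x) + dir μ x (Y x) ≠ 0 := fun h ↦ hne (by linarith)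
  have h6 : (c * dir f x (Y x) + dir μ x (Y x)) • X x
      = (c * dir f x (X x) + dir μ x (X x)) • Y x := by
    linear_combination (norm := module) h4
  refine hu ((c * dir f x (Y x) + dir μ x (Y x))⁻¹ * (c * dir f x (X x) + dir μ x (X x))) ?_
  rw [mul_smul, ← h6, inv_smul_smul₀ hs]

end ParaGeom

end

theorem theorem3p2
    {M : Type*} [TopologicalSpace M] [T2Space M] [SecondCountableTopology M]
    [ChartedSpace (EuclideanSpace ℝ (Fin 3)) M]
    [IsManifold 𝓘(ℝ, EuclideanSpace ℝ (Fin 3)) ∞ M]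
    (φ : ParaGeom.EndField (EuclideanSpace ℝ (Fin 3)) M)
    (ζ : ParaGeom.VField (EuclideanSpace ℝ (Fin 3)) M)
    (η : ParaGeom.OneForm (EuclideanSpace ℝ (Fin 3)) M)
    (g : ParaGeom.BilinField (EuclideanSpace ℝ (Fin 3)) M)
    (hM : ParaGeom.IsParaKenmotsu φ ζ η g)
    (hr : ∃ c : ℝ, ∀ x : M, ParaGeom.scal g x = c)
    (h f lam : M → ℝ) (α β : ℝ)
    (hs : ParaGeom.IsHAlmostGradientRYSoliton g h f lam α β)
    (hh : ∃ c : ℝ, ∀ x : M, h x = c) :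
    (∀ x : M, ParaGeom.scal g x = -6) ∧
    (∀ x : M, h x • ParaGeom.grad g f x = -ParaGeom.grad g lam x) ∧
    ParaGeom.IsAlmostGradientRYSoliton g (fun x ↦ -lam x) lam α β := by
  obtain ⟨r, hr⟩ := hr
  obtain ⟨c, hc⟩ := hh
  have hE : Module.finrank ℝ (EuclideanSpace ℝ (Fin 3)) = 3 := finrank_euclideanSpace_fin
  have hg := hM.metric
  have hR := hM.curvatureAt_of_scal_const hE hr
  have hscal : ∀ x : M, ParaGeom.scal g x = -6 := fun x ↦ by
    rw [hM.scal_eq hE (hR x)]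
    ring
  have hric : ∀ (x : M) (v w : ParaGeom.T (EuclideanSpace ℝ (Fin 3)) x),
      ParaGeom.ricci g x v w = -2 * g x v w := fun x v w ↦ by
    rw [hM.ricci_eq hE (hR x)]
    ring
  -- The constant comes from $-\frac{\beta}{2}r=3\beta$ and $\alpha S=-2\alpha g$; it disappears on
  -- differentiating.
  have hμ : ParaGeom.SmoothF (EuclideanSpace ℝ (Fin 3)) (fun y ↦ lam y + (3 * β - 2 * α)) :=
    hs.smooth_lam.add contMDiff_const
  have hdir : ∀ (x : M) (v : ParaGeom.T (EuclideanSpace ℝ (Fin 3)) x),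
      c * ParaGeom.dir f x v = -ParaGeom.dir lam x v := by
    intro x v
    have h1 := hg.grad_of_hess_eq (c := c) hE
      (fun x u v w ↦ by simp [hR, ParaGeom.modelCurvature]) hs.smooth_potential hμ
      (fun x v w ↦ by
        have h2 := hs.eqn x v w
        rw [hc, hscal, hric] at h2
        linarith) x v
    rwa [ParaGeom.dir_add (ParaGeom.SmoothF.mdiff hs.smooth_lam x) mdifferentiableAt_const,
      ParaGeom.dir_const, add_zero] at h1
  -- An equality of fields, not only at a point, so that it can be put under $\nabla$ to compare the
  -- two Hessians.
  have hgrad : ParaGeom.grad g (fun x ↦ -lam x) = c • ParaGeom.grad g f := by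
    ext1 x
    refine hg.ext fun w ↦ ?_
    rw [Pi.smul_apply, map_smul, smul_apply, hg.grad_spec, hg.grad_spec, ParaGeom.dir_neg,
      smul_eq_mul, hdir]
  refine ⟨hscal, fun x ↦ ?_, hs.smooth_lam.neg, hs.smooth_lam, fun x v w ↦ ?_⟩
  · refine hg.ext fun w ↦ ?_
    rw [hc, map_smul, map_neg, smul_apply, neg_apply, hg.grad_spec, hg.grad_spec, smul_eq_mul,
      hdir]
  · have h1 := hs.eqn x v w
    rw [← h1, hc, ParaGeom.hess, ParaGeom.hess, hgrad, hg.nabla_const_smul_right c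
      (ParaGeom.vdiff_extend v) ((hg.smoothV_grad hs.smooth_potential).vdiff x), map_smul,
      smul_apply, smul_eq_mul]
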